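/- Let $d\ge 1$ and $V:\mathbb Z^d\to\mathbb R$. Let $|n|=\big(\sum_j n_j^2\big)^{1/2}$ be the Euclidean norm, let $\delta_1,\dots,\delta_d$ be the standard basis of $\mathbb Z^d$, and set $\log_0x=x$, $\log_{k+1}x=\log(\log_kx)$. Let $$(-\Delta\psi)_n=\sum_{m\in\mathbb Z^d,\ |m-n|=1}(\psi_n-\psi_m),\qquad (H_V\psi)_n=(-\Delta\psi)_n+V_n\psi_n ,$$ where $H_V=-\Delta+V$ is regarded as a self-adjoint (in general unbounded) operator in $\ell^2(\mathbb Z^d)$ on the maximal domain $\{\psi\in\ell^2(\mathbb Z^d): V\psi\in\ell^2(\mathbb Z^d)\}$. Let $\sigma(H_V)$ be its spectrum and $\sigma_{\rm p}(H_V)$ its set of eigenvalues (with $\inf\sigma(H_V)=-\infty$ if $\sigma(H_V)$ is not bounded from below). Suppose that there is $s\in\mathbb N_0=\{0,1,2,\dots\}$ such that, for all $n\in\mathbb Z^d$ with $|n|$ sufficiently large, $$V_n\le -2d+\sum_{j=1}^d\left[\left(\frac{|n|}{|n+\delta_j|}\right)^{d/2}\prod_{i=1}^s\sqrt{\frac{\log_i|n|}{\log_i|n+\delta_j|}}+\left(\frac{|n|}{|n-\delta_j|}\right)^{d/2}\prod_{i=1}^s\sqrt{\frac{\log_i|n|}{\log_i|n-\delta_j|}}\,\right]$$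 (for $|n|$ large the right-hand side is $(\Delta b^s)_n/b^s_n$ with $b^s_n=|n|^{-d/2}\prod_{i=1}^s(\log_i|n|)^{-1/2}$). Then $H_V$ has no zero-energy ground state, that is, $0\notin\sigma_{\rm p}(H_V)$ or $0\ne\inf\sigma(H_V)$. In particular, $H_V$ has no zero-energy ground state if there is $s\in\mathbb N_0$ such that, for all $n\in\mathbb Z^d$ with $|n|$ sufficiently large, $$V_n\le\frac{d(4-d)}{4|n|^2}+\frac1{|n|^2}\sum_{j=1}^s\prod_{k=1}^j\frac1{\log_k|n|}.$$ -/

import Mathlib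

/-- The Euclidean norm `|n| = √(∑ⱼ |nⱼ|²)` of a lattice point `n ∈ ℤᵈ`. -/
noncomputable def latticeNorm {d : ℕ} (n : Fin d → ℤ) : ℝ :=
  Real.sqrt (∑ j, (n j : ℝ) ^ 2)

/-- The iterated logarithm: `log₀ x = x`, `log_{k+1} x = log (log_k x)`. -/
noncomputable def iterLog (k : ℕ) (x : ℝ) : ℝ :=
  Real.log^[k] x

/-- The `j`-th vector `δⱼ` of the standard basis. -/
def latticeBasis {d : ℕ} (j : Fin d) : Fin d → ℤ :=
  Pi.single j 1

/-- The discrete operator `-Δ` acting on arbitrary functions on `ℤᵈ`: the sum of `ψ n - ψ m` over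
the `2d` nearest neighbours `m = n ± δⱼ` of `n`. See `negLaplacian_eq_finsum`. -/
noncomputable def negLaplacian {d : ℕ} (ψ : (Fin d → ℤ) → ℂ) (n : Fin d → ℤ) : ℂ :=
  ∑ j, ((ψ n - ψ (n + latticeBasis j)) + (ψ n - ψ (n - latticeBasis j)))

/-- The lattice points at Euclidean distance one are exactly the points `n ± δⱼ`. -/
theorem latticeNorm_sub_eq_one_iff {d : ℕ} (n m : Fin d → ℤ) :
    latticeNorm (m - n) = 1 ↔
      ∃ j : Fin d, m = n + latticeBasis j ∨ m = n - latticeBasis j := by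
  have key : latticeNorm (m - n) = 1 ↔ ∑ j, (m - n) j ^ 2 = 1 := by
    unfold latticeNorm
    rw [Real.sqrt_eq_one]
    exact_mod_cast Iff.rfl
  rw [key]
  constructor
  · intro h
    have hne : ∃ j, (m - n) j ≠ 0 := by
      by_contra hcon
      push Not at hcon
      simp [hcon] at h
    obtain ⟨j, hj⟩ := hne
    have hsplit := Finset.add_sum_erase Finset.univ (fun i => (m - n) i ^ 2) (Finset.mem_univ j)
    have h1 : 1 ≤ (m - n) j ^ 2 := by
      have := sq_pos_of_ne_zero hj
      omega
    have h2 : 0 ≤ ∑ i ∈ Finset.univ.erase j, (m - n) i ^ 2 :=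
      Finset.sum_nonneg fun i _ => sq_nonneg _
    have h3 : ∑ i ∈ Finset.univ.erase j, (m - n) i ^ 2 = 0 := by
      omega
    have h4 : (m - n) j ^ 2 = 1 := by
      omega
    have h5 : ∀ i, i ≠ j → m i = n i := by
      intro i hi
      have := (Finset.sum_eq_zero_iff_of_nonneg (fun i _ => sq_nonneg ((m - n) i))).1 h3 i
        (by simp [hi])
      have h6 : (m - n) i = 0 := by simpa using this
      rw [Pi.sub_apply] at h6
      omega
    refine ⟨j, ?_⟩
    rcases mul_self_eq_one_iff.1 ((sq _).symm.trans h4) with h6 | h6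
    · left
      ext i
      by_cases hi : i = j
      · subst hi
        rw [Pi.sub_apply] at h6
        simp [latticeBasis]
        omega
      · simp [latticeBasis, hi, h5 i hi]
    · right
      ext i
      by_cases hi : i = j
      · subst hi
        rw [Pi.sub_apply] at h6
        simp [latticeBasis]
        omega
      · simp [latticeBasis, hi, h5 i hi]
  · rintro ⟨j, h | h⟩ <;> subst h <;>
      simp [latticeBasis, Pi.single_apply]

/-- `(-Δψ)ₙ = ∑_{|m - n| = 1} (ψₙ - ψₘ)`. -/
theorem negLaplacian_eq_finsum {d : ℕ} (ψ : (Fin d → ℤ) → ℂ) (n : Fin d → ℤ) :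
    negLaplacian ψ n = ∑ᶠ m ∈ {m : Fin d → ℤ | latticeNorm (m - n) = 1}, (ψ n - ψ m) := by
  classical
  let g : Fin d × Bool → (Fin d → ℤ) :=
    fun p => n + Pi.single p.1 (if p.2 then (1 : ℤ) else -1)
  have hg : Function.Injective g := by
    rintro ⟨j, b⟩ ⟨j', b'⟩ h
    have h' : (Pi.single j (if b then (1 : ℤ) else -1) : Fin d → ℤ)
        = Pi.single j' (if b' then (1 : ℤ) else -1) := add_left_cancel h
    have h1 := congrFun h' j
    have hjj : j = j' := by
      by_contra hne
      rw [Pi.single_eq_same, Pi.single_eq_of_ne hne] at h1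
      cases b <;> simp at h1
    subst hjj
    rw [Pi.single_eq_same, Pi.single_eq_same] at h1
    cases b <;> cases b' <;> simp at h1 ⊢
  have hset : {m : Fin d → ℤ | latticeNorm (m - n) = 1} = ↑(Finset.univ.image g) := by
    ext m
    simp only [Set.mem_ofPred_eq, latticeNorm_sub_eq_one_iff, Finset.coe_image, Finset.coe_univ,
      Set.image_univ, Set.mem_range, Prod.exists, Bool.exists_bool, g, latticeBasis]
    refine exists_congr fun j => ?_
    simp only [if_true, Bool.false_eq_true, if_false, Pi.single_neg, ← sub_eq_add_neg]
    constructor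
    · rintro (h | h)
      · exact Or.inr h.symm
      · exact Or.inl h.symm
    · rintro (h | h)
      · exact Or.inr h.symm
      · exact Or.inl h.symm
  rw [hset, finsum_mem_coe_finset, Finset.sum_image (fun _ _ _ _ h => hg h),
    Fintype.sum_prod_type]
  simp [negLaplacian, g, latticeBasis, Pi.single_neg, sub_eq_add_neg]

/-- The Hilbert space `ℓ²(ℤᵈ)` of square-summable complex-valued functions. -/
abbrev LatticeL2 (d : ℕ) : Type :=
  lp (fun _ : Fin d → ℤ => ℂ) 2

/-- Square-summability is invariant under translations. -/
theorem memlp_translate {d : ℕ} {ψ : (Fin d → ℤ) → ℂ} (hψ : Memℓp ψ 2) (v : Fin d → ℤ) :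
    Memℓp (fun n => ψ (n + v)) 2 := by
  have h2 : 0 < (2 : ENNReal).toReal := by norm_num
  rw [memℓp_gen_iff h2] at hψ ⊢
  exact (Equiv.addRight v).summable_iff.2 hψ

/-- The operator `-Δ` maps `ℓ²(ℤᵈ)` into itself. -/
theorem memlp_negLaplacian {d : ℕ} {ψ : (Fin d → ℤ) → ℂ} (hψ : Memℓp ψ 2) :
    Memℓp (negLaplacian ψ) 2 := by
  have h : Memℓp (fun n => ∑ j ∈ (Finset.univ : Finset (Fin d)),
      ((ψ n - ψ (n + latticeBasis j)) + (ψ n - ψ (n + -latticeBasis j)))) 2 :=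
    Memℓp.finsetSum (f := fun (j : Fin d) (n : Fin d → ℤ) =>
        ((ψ n - ψ (n + latticeBasis j)) + (ψ n - ψ (n + -latticeBasis j)))) Finset.univ
      fun j _ => (hψ.sub (memlp_translate hψ _)).add (hψ.sub (memlp_translate hψ _))
  have heq : negLaplacian ψ = fun n => ∑ j ∈ (Finset.univ : Finset (Fin d)),
      ((ψ n - ψ (n + latticeBasis j)) + (ψ n - ψ (n + -latticeBasis j))) := by
    funext n
    simp only [negLaplacian, ← sub_eq_add_neg]
  rw [heq]
  exact h

/-- The maximal domain `{ψ ∈ ℓ²(ℤᵈ) | Vψ ∈ ℓ²(ℤᵈ)}` of multiplication by `V`. -/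
def potentialDomain {d : ℕ} (V : (Fin d → ℤ) → ℝ) : Submodule ℂ (LatticeL2 d) where
  carrier := {ψ | Memℓp (fun n => (V n : ℂ) * ψ n) 2}
  zero_mem' := by
    have h : Memℓp (0 : (Fin d → ℤ) → ℂ) 2 := zero_memℓp
    simpa [Pi.zero_def] using h
  add_mem' := by
    intro ψ φ hψ hφ
    have h := Memℓp.add hψ hφ
    simpa [Pi.add_def, mul_add] using h
  smul_mem' := by
    intro c ψ hψ
    have h := Memℓp.const_smul hψ c
    simpa [Pi.smul_def, mul_left_comm] using h

/-- The discrete Schrödinger operator `H_V = -Δ + V` in `ℓ²(ℤᵈ)`, as an (in general unbounded)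
operator on the maximal domain of `V`. -/
noncomputable def schrodinger {d : ℕ} (V : (Fin d → ℤ) → ℝ) :
    LatticeL2 d →ₗ.[ℂ] LatticeL2 d where
  domain := potentialDomain V
  toFun :=
    { toFun := fun ψ =>
        ⟨fun n => negLaplacian (ψ : LatticeL2 d) n + (V n : ℂ) * (ψ : LatticeL2 d) n,
          (memlp_negLaplacian (lp.memℓp (ψ : LatticeL2 d))).add ψ.2⟩
      map_add' := by
        intro ψ φ
        ext n
        simp only [negLaplacian, Submodule.coe_add, lp.coeFn_add, Pi.add_apply]
        rw [add_add_add_comm, ← Finset.sum_add_distrib, mul_add]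
        congr 1
        exact Finset.sum_congr rfl fun j _ => by ring
      map_smul' := by
        intro c ψ
        ext n
        simp only [negLaplacian, Submodule.coe_smul, lp.coeFn_smul, Pi.smul_apply, smul_eq_mul,
          RingHom.id_apply, mul_add, Finset.mul_sum]
        congr 1
        · exact Finset.sum_congr rfl fun j _ => by ring
        · ring }

/-- The spectrum `σ(A)` of an operator `A` with domain in a complex normed space: the set of all
`z` such that `A - z : Dom A → E` has no bounded everywhere defined two-sided inverse. -/
def pmapSpectrum {E : Type*} [NormedAddCommGroup E] [NormedSpace ℂ E] (A : E →ₗ.[ℂ] E) :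
    Set ℂ :=
  {z | ¬ ∃ R : E →L[ℂ] E,
    (∀ f : E, ∃ h : R f ∈ A.domain, A ⟨R f, h⟩ - z • R f = f) ∧
    (∀ ψ : A.domain, R (A ψ - z • (ψ : E)) = ψ)}

/-- The point spectrum `σₚ(A)`: the set of eigenvalues of `A`. -/
def pmapPointSpectrum {E : Type*} [NormedAddCommGroup E] [NormedSpace ℂ E] (A : E →ₗ.[ℂ] E) :
    Set ℂ :=
  {z | ∃ ψ : A.domain, (ψ : E) ≠ 0 ∧ A ψ = z • (ψ : E)}

/-- The infimum `inf σ(A)` of the spectrum of an operator with real spectrum, in the extended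
reals; it is `-∞` if the spectrum is not bounded from below. -/
noncomputable def infSpectrum {E : Type*} [NormedAddCommGroup E] [NormedSpace ℂ E]
    (A : E →ₗ.[ℂ] E) : EReal :=
  sInf ((fun z : ℂ => (z.re : EReal)) '' pmapSpectrum A)

/-!
Suppose that `0` is an eigenvalue of `H_V` and the infimum of its spectrum. Then the quadratic form
of `H_V` is nonnegative (`re_inner_nonneg_of_pmapSpectrum`), the modulus of an eigenfunction
minimizes it, and by the discrete Harnack principle it is a strictly positive square-summable
solution `u` of `H_V u = 0` (`exists_pos_ground_state`).

Let `b` be the critical profile `|n| ^ (-d/2) ∏ᵢ (logᵢ |n|) ^ (-1/2)`. The hypothesis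
`V ≤ (Δb) / b` near infinity says that `u / b` is superharmonic there for the edge weights
`b n * b m`. Since `b n ^ 2 = O(|n| ^ (-d))`, linear cutoffs at scale `R` have energy
`O(1 / R)`, so this weighted graph is recurrent and `u ≥ c b` for some `c > 0`
(`le_of_superharmonic_outside_finite`). But `∑ b n ^ 2` diverges by comparison with a telescoping
series of `log_{s+1}` (`not_summable_of_critical_le`), which contradicts `u ∈ ℓ²`.

The explicit condition on `V` reduces to this criterion with `s + 1` logarithms. Expanding the
quotients of the profile to second order in the relative change of `|n| ^ 2`
(`profileRatio_expansion`), one finds that `(Δb) / b` is the explicit expression plus a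
surplus of order at least `|n| ^ (-2) (log |n|) ^ (-2)`, up to an error `O(|n| ^ (-3))`
(`eventually_le_sum_profileRatio`).
-/

open Filter Topology Asymptotics

/-! ### Nonnegativity of the form from the spectrum -/

/-- A symmetric, possibly unbounded operator `A` whose spectrum lies in the right half-plane has a
nonnegative quadratic form. For `l < 0` the resolvent `R = (A - l)⁻¹` is bounded and self-adjoint,
and a point `μ < 0` of its spectrum would produce the negative point `l + 1/μ` of the spectrum of
`A`. Hence `R ≥ 0`, so that `⟨(A - l)ψ, ψ⟩ = ⟨(A - l)ψ, R (A - l)ψ⟩ ≥ 0`, and `l` may tend to `0`.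
-/
theorem re_inner_nonneg_of_pmapSpectrum {E : Type*} [NormedAddCommGroup E] [InnerProductSpace ℂ E]
    [CompleteSpace E] {A : E →ₗ.[ℂ] E}
    (hA : ∀ ψ φ : A.domain, inner ℂ (A ψ) (φ : E) = inner ℂ (ψ : E) (A φ))
    (hspec : ∀ z ∈ pmapSpectrum A, 0 ≤ z.re) (ψ : A.domain) :
    0 ≤ (inner ℂ (A ψ) (ψ : E)).re := by
  have hres : ∀ l : ℝ, l < 0 → ∃ R : E →L[ℂ] E,
      (∀ f : E, ∃ h : R f ∈ A.domain, A ⟨R f, h⟩ - (l : ℂ) • R f = f) ∧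
      (∀ ψ : A.domain, R (A ψ - (l : ℂ) • (ψ : E)) = ψ) := by
    intro l hl
    by_contra hcon
    have := hspec (l : ℂ) hcon
    rw [Complex.ofReal_re] at this
    linarith
  have key : ∀ l : ℝ, l < 0 → l * ‖(ψ : E)‖ ^ 2 ≤ (inner ℂ (A ψ) (ψ : E)).re := by
    intro l hl
    obtain ⟨R, hR1, hR2⟩ := hres l hl
    have hsymm : R.IsSymmetric := by
      intro f g
      obtain ⟨hf, hf'⟩ := hR1 f
      obtain ⟨hg, hg'⟩ := hR1 g
      change inner ℂ (R f) g = inner ℂ f (R g)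
      have h := hA ⟨R f, hf⟩ ⟨R g, hg⟩
      dsimp only at h
      conv_lhs => rw [← hg']
      conv_rhs => rw [← hf']
      rw [inner_sub_left, inner_sub_right, inner_smul_left, inner_smul_right, h]
      simp
    have hsa : IsSelfAdjoint R := (ContinuousLinearMap.isSelfAdjoint_iff_isSymmetric).2 hsymm
    have hnonneg : 0 ≤ R := by
      rw [StarOrderedRing.nonneg_iff_spectrum_nonneg (R := ℝ) R hsa]
      intro μ hμ
      by_contra hneg
      push Not at hneg
      have hμ0 : (μ : ℂ) ≠ 0 := by exact_mod_cast hneg.ne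
      obtain ⟨T, hT1, hT2⟩ := hres (l + μ⁻¹) (by have := inv_lt_zero.2 hneg; linarith)
      -- The resolvent identity at the points `l` and `l + μ⁻¹`, in both orders.
      have hRT : ∀ f, R f = T f - (μ : ℂ)⁻¹ • R (T f) := by
        intro f
        obtain ⟨h, h'⟩ := hT1 f
        have h3 := hR2 ⟨T f, h⟩
        have h4 : f = (A ⟨T f, h⟩ - (l : ℂ) • T f) - (μ : ℂ)⁻¹ • T f := by
          conv_lhs => rw [← h']
          push_cast
          module
        conv_lhs => rw [h4]
        rw [map_sub, h3, map_smul]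
      have hTR : ∀ f, T f = R f + (μ : ℂ)⁻¹ • T (R f) := by
        intro f
        obtain ⟨h, h'⟩ := hR1 f
        have h3 := hT2 ⟨R f, h⟩
        have h4 : f = (A ⟨R f, h⟩ - ((l + μ⁻¹ : ℝ) : ℂ) • R f) + (μ : ℂ)⁻¹ • R f := by
          conv_lhs => rw [← h']
          push_cast
          module
        conv_lhs => rw [h4]
        rw [map_add, h3, map_smul]
      have hRT' : ∀ f, R (T f) = (μ : ℂ) • (T f - R f) := by
        intro f
        rw [hRT f, sub_sub_cancel, smul_smul, mul_inv_cancel₀ hμ0, one_smul]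
      have hTR' : ∀ f, T (R f) = (μ : ℂ) • (T f - R f) := by
        intro f
        rw [hTR f, add_sub_cancel_left, smul_smul, mul_inv_cancel₀ hμ0, one_smul]
      apply hμ
      rw [spectrum.mem_resolventSet_iff]
      have hal : algebraMap ℝ (E →L[ℂ] E) μ = (μ : ℂ) • (1 : E →L[ℂ] E) := by
        rw [Algebra.algebraMap_eq_smul_one]
        ext x
        simp
      rw [hal]
      refine ⟨⟨(μ : ℂ) • (1 : E →L[ℂ] E) - R,
        (μ : ℂ)⁻¹ • (1 : E →L[ℂ] E) + ((μ : ℂ)⁻¹ * (μ : ℂ)⁻¹) • T, ?_, ?_⟩, rfl⟩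
      · ext f
        change (μ : ℂ) • ((μ : ℂ)⁻¹ • f + ((μ : ℂ)⁻¹ * (μ : ℂ)⁻¹) • T f) -
          R ((μ : ℂ)⁻¹ • f + ((μ : ℂ)⁻¹ * (μ : ℂ)⁻¹) • T f) = f
        rw [map_add, map_smul, map_smul, hRT']
        match_scalars <;> field_simp <;> ring
      · ext f
        change (μ : ℂ)⁻¹ • ((μ : ℂ) • f - R f) +
          ((μ : ℂ)⁻¹ * (μ : ℂ)⁻¹) • T ((μ : ℂ) • f - R f) = f
        rw [map_sub, map_smul, hTR']
        match_scalars <;> field_simp <;> ring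
    have hpos := ((ContinuousLinearMap.nonneg_iff_isPositive R).1 hnonneg).re_inner_nonneg_right
      (A ψ - (l : ℂ) • (ψ : E))
    rw [hR2 ψ, inner_sub_left, inner_smul_left] at hpos
    simp only [Complex.conj_ofReal, map_sub, RCLike.re_to_complex, Complex.re_ofReal_mul] at hpos
    have hn := inner_self_eq_norm_sq (𝕜 := ℂ) (ψ : E)
    rw [RCLike.re_to_complex] at hn
    rw [hn] at hpos
    linarith
  -- If the form value `q` were negative, this choice of `l` would contradict `key`.
  by_contra hcon
  push Not at hcon
  set q := (inner ℂ (A ψ) (ψ : E)).re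
  have h := key (q / (2 * (‖(ψ : E)‖ ^ 2 + 1))) (div_neg_of_neg_of_pos hcon (by positivity))
  have h0 : 0 ≤ ‖(ψ : E)‖ ^ 2 := by positivity
  rw [div_mul_eq_mul_div, div_le_iff₀ (by positivity)] at h
  nlinarith

/-! ### Positive ground states -/

/-- A vector at which a nonnegative form is not positive minimizes the form, so its image is
orthogonal (in real part) to the domain. -/
theorem re_inner_eq_zero_of_form_nonneg {E : Type*} [NormedAddCommGroup E]
    [InnerProductSpace ℂ E] {A : E →ₗ.[ℂ] E}
    (hA : ∀ ψ φ : A.domain, inner ℂ (A ψ) (φ : E) = inner ℂ (ψ : E) (A φ))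
    (hpos : ∀ ψ : A.domain, 0 ≤ (inner ℂ (A ψ) (ψ : E)).re)
    {ψ : A.domain} (hψ : (inner ℂ (A ψ) (ψ : E)).re ≤ 0) (φ : A.domain) :
    (inner ℂ (A ψ) (φ : E)).re = 0 := by
  have hcross : (inner ℂ (A φ) (ψ : E)).re = (inner ℂ (A ψ) (φ : E)).re := by
    rw [hA φ ψ, ← inner_conj_symm, Complex.conj_re]
  set x := (inner ℂ (A ψ) (φ : E)).re with hx
  set y := (inner ℂ (A φ) (φ : E)).re with hy
  have hquad : ∀ ε : ℝ, 0 ≤ 2 * ε * x + ε ^ 2 * y := by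
    intro ε
    have h := hpos (ψ + (ε : ℂ) • φ)
    simp only [LinearPMap.map_add, LinearPMap.map_smul, Submodule.coe_add, Submodule.coe_smul,
      inner_add_left, inner_add_right, inner_smul_left, inner_smul_right, Complex.conj_ofReal,
      Complex.add_re, Complex.re_ofReal_mul, hcross] at h
    rw [← hx, ← hy] at h
    nlinarith
  have hy0 : 0 ≤ y := hpos φ
  -- The vertex of the parabola would be at `-x / y`; the denominator `y + 1` avoids division by zero.
  have h := hquad (-x / (y + 1))
  have h2 : 2 * (-x / (y + 1)) * x + (-x / (y + 1)) ^ 2 * y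
      = - (x ^ 2 * (y + 2) / (y + 1) ^ 2) := by
    field_simp
    ring
  rw [h2] at h
  have h3 : x ^ 2 * (y + 2) / (y + 1) ^ 2 ≤ 0 := by linarith
  rw [div_le_iff₀ (by positivity)] at h3
  nlinarith [sq_nonneg x]

/-- Translation differences of a summable family sum to zero; this is summation by parts on a
group. -/
theorem hasSum_sub_translate {G α : Type*} [AddCommGroup G] [AddCommGroup α]
    [TopologicalSpace α] [IsTopologicalAddGroup α] {c : G → α} (hc : Summable c) (v : G) :
    HasSum (fun n => c n - c (n - v)) 0 := by
  have h := hc.hasSum.sub ((Equiv.subRight v).hasSum_iff.2 hc.hasSum)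
  simpa using h

theorem schrodinger_symmetric {d : ℕ} (V : (Fin d → ℤ) → ℝ) (ψ φ : (schrodinger V).domain) :
    inner ℂ (schrodinger V ψ) (φ : LatticeL2 d) = inner ℂ (ψ : LatticeL2 d) (schrodinger V φ) := by
  have h1 := lp.hasSum_inner (𝕜 := ℂ) (schrodinger V ψ) (φ : LatticeL2 d)
  have h2 := lp.hasSum_inner (𝕜 := ℂ) (ψ : LatticeL2 d) (schrodinger V φ)
  -- Translates are again in `ℓ²`, so all products occurring below are summable.
  have htr : ∀ (f : LatticeL2 d) (v : Fin d → ℤ), ∃ g : LatticeL2 d, ∀ n, g n = f (n + v) :=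
    fun f v => ⟨⟨_, memlp_translate (lp.memℓp f) v⟩, fun n => rfl⟩
  have hc : ∀ v, Summable fun n => (φ : LatticeL2 d) (n + v) *
      (starRingEnd ℂ) ((ψ : LatticeL2 d) n) := by
    intro v
    obtain ⟨g, hg⟩ := htr φ v
    simpa [hg] using lp.summable_inner (𝕜 := ℂ) (ψ : LatticeL2 d) g
  have he : ∀ v, Summable fun n => (φ : LatticeL2 d) n *
      (starRingEnd ℂ) ((ψ : LatticeL2 d) (n + v)) := by
    intro v
    obtain ⟨g, hg⟩ := htr ψ v
    simpa [hg] using lp.summable_inner (𝕜 := ℂ) g (φ : LatticeL2 d)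
  have h3 := hasSum_sum (s := Finset.univ) fun (j : Fin d) _ =>
    (hasSum_sub_translate (hc (latticeBasis j)) (latticeBasis j)).sub
      (hasSum_sub_translate (he (latticeBasis j)) (latticeBasis j))
  have h4 := h1.sub h2
  rw [← sub_eq_zero]
  refine (h4.unique ?_)
  simp only [sub_zero, Finset.sum_const_zero] at h3
  convert h3 using 2 with n
  change inner ℂ (negLaplacian (ψ : LatticeL2 d) n + (V n : ℂ) * (ψ : LatticeL2 d) n) _ -
    inner ℂ _ (negLaplacian (φ : LatticeL2 d) n + (V n : ℂ) * (φ : LatticeL2 d) n) = _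
  simp only [RCLike.inner_apply, negLaplacian, map_add, map_sum, map_mul, Complex.conj_ofReal,
    map_sub, mul_add, add_mul, Finset.mul_sum, Finset.sum_mul, sub_add_cancel]
  rw [add_sub_add_comm, ← Finset.sum_sub_distrib]
  have : (φ : LatticeL2 d) n * ((V n : ℂ) * (starRingEnd ℂ) ((ψ : LatticeL2 d) n)) -
      (V n : ℂ) * (φ : LatticeL2 d) n * (starRingEnd ℂ) ((ψ : LatticeL2 d) n) = 0 := by ring
  rw [this, add_zero]
  exact Finset.sum_congr rfl fun j _ => by ring

/-- Connectedness of the nearest-neighbour graph of `ℤᵈ`. -/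
theorem lattice_induction {d : ℕ} {P : (Fin d → ℤ) → Prop}
    (hadd : ∀ n j, P n → P (n + latticeBasis j)) (hsub : ∀ n j, P n → P (n - latticeBasis j))
    {m : Fin d → ℤ} (hm : P m) (n : Fin d → ℤ) : P n := by
  have h1 : ∀ (j : Fin d) (k : ℤ) (m : Fin d → ℤ), P m → P (m + k • latticeBasis j) := by
    intro j k
    induction k with
    | zero => intro m hm; simpa using hm
    | succ i ih =>
      intro m hm
      have := hadd _ j (ih m hm)
      rwa [add_assoc, ← add_one_zsmul] at this
    | pred i ih =>
      intro m hm
      have := hsub _ j (ih m hm)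
      rwa [add_sub_assoc, sub_eq_add_neg (_ • _), ← sub_one_zsmul] at this
  have h2 : ∀ s : Finset (Fin d), P (m + ∑ j ∈ s, (n - m) j • latticeBasis j) := by
    intro s
    induction s using Finset.induction_on with
    | empty => simpa using hm
    | insert j s hj ih =>
      rw [Finset.sum_insert hj, add_comm (_ • _), ← add_assoc]
      exact h1 j _ _ ih
  have h3 := h2 Finset.univ
  have h4 : ∑ j, (n - m) j • latticeBasis j = n - m := by
    ext i
    simp [latticeBasis, Finset.sum_apply, Pi.single_apply]
  rwa [h4, add_sub_cancel] at h3

/-- If zero is an eigenvalue at the bottom of the spectrum, then there is a strictly positive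
square-summable solution of `H_V u = 0`, namely the modulus of an eigenfunction. -/
theorem exists_pos_ground_state {d : ℕ} {V : (Fin d → ℤ) → ℝ}
    (h0 : 0 ∈ pmapPointSpectrum (schrodinger V)) (hinf : 0 = infSpectrum (schrodinger V)) :
    ∃ u : (Fin d → ℤ) → ℝ, (∀ n, 0 < u n) ∧ (Summable fun n => u n ^ 2) ∧
      ∀ n, ∑ j, (u (n + latticeBasis j) + u (n - latticeBasis j)) = (2 * d + V n) * u n := by
  have hspec : ∀ z ∈ pmapSpectrum (schrodinger V), 0 ≤ z.re := by
    intro z hz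
    have h : infSpectrum (schrodinger V) ≤ (z.re : EReal) := sInf_le ⟨z, hz, rfl⟩
    rw [← hinf] at h
    exact_mod_cast h
  have hsymm := schrodinger_symmetric V
  have hpos := re_inner_nonneg_of_pmapSpectrum hsymm hspec
  obtain ⟨ψ, hψ0, hψ⟩ := h0
  have hψn : ∀ n, negLaplacian (ψ : LatticeL2 d) n + (V n : ℂ) * (ψ : LatticeL2 d) n = 0 := by
    intro n
    have h := congrArg (fun f : LatticeL2 d => f n) hψ
    rw [zero_smul] at h
    exact h
  set u : (Fin d → ℤ) → ℝ := fun n => ‖(ψ : LatticeL2 d) n‖ with hu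
  have hu0 : ∀ n, 0 ≤ u n := fun n => norm_nonneg _
  have h2 : 0 < (2 : ENNReal).toReal := by norm_num
  have hmem : Memℓp (fun n => (u n : ℂ)) 2 := by
    have h := lp.memℓp (ψ : LatticeL2 d)
    rw [memℓp_gen_iff h2] at h ⊢
    simpa [hu] using h
  have hmemV : Memℓp (fun n => (V n : ℂ) * (u n : ℂ)) 2 := by
    have h : Memℓp (fun n => (V n : ℂ) * (ψ : LatticeL2 d) n) 2 := ψ.2
    rw [memℓp_gen_iff h2] at h ⊢
    simpa [hu] using h
  let U : (schrodinger V).domain := ⟨⟨_, hmem⟩, hmemV⟩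
  have hUn : ∀ n, (schrodinger V U : LatticeL2 d) n =
      (((2 * d + V n) * u n - ∑ j, (u (n + latticeBasis j) + u (n - latticeBasis j)) : ℝ) : ℂ) := by
    intro n
    change negLaplacian (fun n => (u n : ℂ)) n + (V n : ℂ) * (u n : ℂ) = _
    have : negLaplacian (fun n => (u n : ℂ)) n = ∑ j : Fin d, (2 * (u n : ℂ)) -
        ∑ j, ((u (n + latticeBasis j) : ℂ) + u (n - latticeBasis j)) := by
      rw [← Finset.sum_sub_distrib]
      exact Finset.sum_congr rfl fun j _ => by ring
    rw [this]
    push_cast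
    simp
    ring
  -- The modulus is a subsolution: `H_V u ≤ 0` by the triangle inequality.
  have hle : ∀ n, (2 * d + V n) * u n ≤
      ∑ j, (u (n + latticeBasis j) + u (n - latticeBasis j)) := by
    intro n
    have h : (((2 * d + V n : ℝ)) : ℂ) * (ψ : LatticeL2 d) n =
        ∑ j, ((ψ : LatticeL2 d) (n + latticeBasis j) + (ψ : LatticeL2 d) (n - latticeBasis j)) := by
      have h := hψn n
      have h3 : negLaplacian (ψ : LatticeL2 d) n = ∑ j : Fin d, (2 * (ψ : LatticeL2 d) n) -
          ∑ j, ((ψ : LatticeL2 d) (n + latticeBasis j) +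
            (ψ : LatticeL2 d) (n - latticeBasis j)) := by
        rw [← Finset.sum_sub_distrib]
        exact Finset.sum_congr rfl fun j _ => by ring
      rw [h3] at h
      simp only [Finset.sum_const, Finset.card_univ, Fintype.card_fin, nsmul_eq_mul] at h
      push_cast
      linear_combination h
    calc (2 * d + V n) * u n ≤ ‖(((2 * d + V n : ℝ)) : ℂ) * (ψ : LatticeL2 d) n‖ := by
          rw [norm_mul, Complex.norm_real]
          exact mul_le_mul_of_nonneg_right (le_abs_self _) (hu0 n)
      _ ≤ _ := by
          rw [h]
          exact (norm_sum_le _ _).trans (Finset.sum_le_sum fun j _ => norm_add_le _ _)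
  have hUU : (inner ℂ (schrodinger V U) (U : LatticeL2 d)).re ≤ 0 := by
    have h := Complex.hasSum_re (lp.hasSum_inner (𝕜 := ℂ) (schrodinger V U) (U : LatticeL2 d))
    refine h.nonpos fun n => ?_
    rw [RCLike.inner_apply, hUn, Complex.conj_ofReal]
    change ((u n : ℂ) * _).re ≤ 0
    rw [← Complex.ofReal_mul, Complex.ofReal_re]
    exact mul_nonpos_of_nonneg_of_nonpos (hu0 n) (by linarith [hle n])
  -- Its form value is therefore nonpositive, and testing with delta functions gives `H_V u = 0`.
  have heq : ∀ n, ∑ j, (u (n + latticeBasis j) + u (n - latticeBasis j)) =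
      (2 * d + V n) * u n := by
    intro n
    classical
    have hsm : Memℓp (fun m => (V m : ℂ) * (lp.single 2 n (1 : ℂ) : LatticeL2 d) m) 2 := by
      have h := lp.memℓp (lp.single 2 n (V n : ℂ) : LatticeL2 d)
      convert h using 1
      ext m
      by_cases hm : m = n
      · subst hm; simp
      · simp [hm]
    have h := re_inner_eq_zero_of_form_nonneg hsymm hpos hUU ⟨lp.single 2 n (1 : ℂ), hsm⟩
    rw [lp.inner_single_right, hUn, RCLike.inner_apply, Complex.conj_ofReal, one_mul,
      Complex.ofReal_re] at h
    linarith
  refine ⟨u, ?_, ?_, heq⟩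
  · -- A zero of `u` forces zeros at all neighbours, hence everywhere.
    by_contra hcon
    push Not at hcon
    obtain ⟨m, hm⟩ := hcon
    have hz : ∀ n, u n = 0 → ∀ j, u (n + latticeBasis j) = 0 ∧ u (n - latticeBasis j) = 0 := by
      intro n hn j
      have h := heq n
      rw [hn, mul_zero, Finset.sum_eq_zero_iff_of_nonneg
        (fun j _ => add_nonneg (hu0 _) (hu0 _))] at h
      have := h j (Finset.mem_univ j)
      constructor <;> linarith [hu0 (n + latticeBasis j), hu0 (n - latticeBasis j)]
    have hall := lattice_induction (P := fun n => u n = 0) (fun n j hn => (hz n hn j).1)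
      (fun n j hn => (hz n hn j).2) (le_antisymm hm (hu0 m))
    apply hψ0
    ext n
    simpa [hu] using hall n
  · have h := lp.memℓp (ψ : LatticeL2 d)
    rw [memℓp_gen_iff h2] at h
    simpa [hu] using h

/-! ### Iterated logarithms and divergence of the critical series -/

theorem iterLog_succ (k : ℕ) (x : ℝ) : iterLog (k + 1) x = Real.log (iterLog k x) :=
  Function.iterate_succ_apply' _ _ _

theorem tendsto_iterLog_atTop (k : ℕ) : Tendsto (iterLog k) atTop atTop := by
  induction k with
  | zero => exact tendsto_id
  | succ k ih =>
    have h := Real.tendsto_log_atTop.comp ih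
    exact h.congr fun x => (iterLog_succ k x).symm

theorem exists_forall_one_le_iterLog (s : ℕ) :
    ∃ X : ℝ, 1 ≤ X ∧ ∀ r, X ≤ r → ∀ i ≤ s, 1 ≤ iterLog i r := by
  have h : ∀ᶠ r in atTop, ∀ i ∈ Finset.range (s + 1), 1 ≤ iterLog i r :=
    (Finset.eventually_all _).2 fun i _ => (tendsto_iterLog_atTop i).eventually_ge_atTop 1
  obtain ⟨X, hX⟩ := eventually_atTop.1 h
  exact ⟨max X 1, le_max_right _ _, fun r hr i hi =>
    hX r ((le_max_left _ _).trans hr) i (Finset.mem_range.2 (by omega))⟩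

theorem iterLog_le_iterLog {s : ℕ} {x y : ℝ} (hx : ∀ i ≤ s, 1 ≤ iterLog i x) (hxy : x ≤ y)
    {i : ℕ} (hi : i ≤ s + 1) : iterLog i x ≤ iterLog i y := by
  induction i with
  | zero => exact hxy
  | succ i ih =>
    rw [iterLog_succ, iterLog_succ]
    exact Real.log_le_log (by linarith [hx i (by omega)]) (ih (by omega))

/-- The mean value estimate for `logⱼ`, whose derivative `1 / (x log x ⋯ log_{j-1} x)` is
decreasing; it follows by iterating `log a ≤ a - 1`. -/
theorem iterLog_sub_iterLog_le {s : ℕ} {x y : ℝ} (hx : ∀ i ≤ s, 1 ≤ iterLog i x) (hxy : x ≤ y)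
    {j : ℕ} (hj : j ≤ s + 1) :
    iterLog j y - iterLog j x ≤ (y - x) / ∏ i ∈ Finset.range j, iterLog i x := by
  induction j with
  | zero => simp [iterLog]
  | succ j ih =>
    have hLx : 0 < iterLog j x := by linarith [hx j (by omega)]
    have hLy : 0 < iterLog j y := hLx.trans_le (iterLog_le_iterLog hx hxy (by omega))
    have h := ih (by omega)
    rw [iterLog_succ, iterLog_succ, Finset.prod_range_succ, ← div_div,
      ← Real.log_div hLy.ne' hLx.ne']
    refine (Real.log_le_sub_one_of_pos (div_pos hLy hLx)).trans ?_
    rw [div_sub_one hLx.ne']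
    gcongr

/-- The product `x log x log₂ x ⋯ logₛ x`, written with the index `0` split off. -/
theorem prod_range_iterLog (s : ℕ) (x : ℝ) :
    ∏ i ∈ Finset.range (s + 1), iterLog i x = x * ∏ i ∈ Finset.Icc 1 s, iterLog i x := by
  induction s with
  | zero => simp [iterLog]
  | succ s ih =>
    rw [Finset.prod_range_succ, ih, Finset.prod_Icc_succ_top (by omega), mul_assoc]

theorem latticeNorm_nonneg {d : ℕ} (n : Fin d → ℤ) : 0 ≤ latticeNorm n := Real.sqrt_nonneg _

/-- Divergence of `∑ 1 / (|n|ᵈ log |n| ⋯ logₛ |n|)` over `ℤᵈ`: for each `k` there are at least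
`k ^ (d - 1)` lattice points with `k ≤ |n| ≤ √d k`, and the resulting series over `k` dominates the
telescoping series of `log_{s+1} (√d (k + 1)) - log_{s+1} (√d k)`. -/
theorem not_summable_of_critical_le {d : ℕ} (hd : 1 ≤ d) (s : ℕ) {w : (Fin d → ℤ) → ℝ}
    (hw0 : ∀ n, 0 ≤ w n) {X : ℝ}
    (hw : ∀ n, X ≤ latticeNorm n →
      (latticeNorm n ^ d * ∏ i ∈ Finset.Icc 1 s, iterLog i (latticeNorm n))⁻¹ ≤ w n) :
    ¬ Summable w := by
  intro hsum
  obtain ⟨e, rfl⟩ : ∃ e, d = e + 1 := ⟨d - 1, by omega⟩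
  obtain ⟨Y, hY1, hY⟩ := exists_forall_one_le_iterLog s
  set D : ℝ := Real.sqrt ((e + 1 : ℕ) : ℝ) with hD
  have hD1 : 1 ≤ D := by
    rw [hD, Real.one_le_sqrt]
    push_cast
    linarith [(Nat.cast_nonneg e : (0 : ℝ) ≤ e)]
  -- The points with first coordinate `k` and the remaining ones in `{0, …, k - 1}`.
  let emb : (Σ k : ℕ, Fin e → Fin k) → (Fin (e + 1) → ℤ) :=
    fun p => Fin.cons (p.1 : ℤ) fun i => ((p.2 i : ℕ) : ℤ)
  have hemb : Function.Injective emb := by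
    rintro ⟨k, m⟩ ⟨k', m'⟩ h
    have h0 := congrFun h 0
    simp only [emb, Fin.cons_zero, Nat.cast_inj] at h0
    subst h0
    congr 1
    ext i
    have hi := congrFun h i.succ
    simpa [emb] using hi
  have hs1 := (hsum.comp_injective hemb).sigma
  simp only [Function.comp_apply, tsum_fintype] at hs1
  have hnorm : ∀ (k : ℕ) (m : Fin e → Fin k),
      (k : ℝ) ≤ latticeNorm (emb ⟨k, m⟩) ∧ latticeNorm (emb ⟨k, m⟩) ≤ D * k := by
    intro k m
    have hkk : (0 : ℝ) ≤ k := Nat.cast_nonneg k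
    unfold latticeNorm
    rw [Fin.sum_univ_succ]
    simp only [emb, Fin.cons_zero, Fin.cons_succ, Int.cast_natCast]
    constructor
    · apply Real.le_sqrt_of_sq_le
      have : 0 ≤ ∑ i, ((m i : ℕ) : ℝ) ^ 2 := Finset.sum_nonneg fun i _ => sq_nonneg _
      linarith
    · rw [Real.sqrt_le_left (by positivity), mul_pow, hD, Real.sq_sqrt (Nat.cast_nonneg _)]
      have : ∑ i, ((m i : ℕ) : ℝ) ^ 2 ≤ ∑ _i : Fin e, (k : ℝ) ^ 2 := by
        refine Finset.sum_le_sum fun i _ => ?_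
        have : ((m i : ℕ) : ℝ) ≤ k := by exact_mod_cast (m i).2.le
        gcongr
      simp only [Finset.sum_const, Finset.card_univ, Fintype.card_fin, nsmul_eq_mul] at this
      push_cast
      linarith
  set a : ℕ → ℝ := fun k => iterLog (s + 1) (D * ((k + 1 : ℕ) : ℝ)) - iterLog (s + 1) (D * k)
    with ha
  have hasum : Summable a := by
    refine Summable.of_norm_bounded_eventually_nat (hs1.mul_left (D ^ (e + 1))) ?_
    filter_upwards [eventually_ge_atTop ⌈max X Y⌉₊] with k hk
    have hk' : max X Y ≤ (k : ℝ) := Nat.ceil_le.1 hk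
    have hkX : X ≤ k := (le_max_left _ _).trans hk'
    have hkY : Y ≤ k := (le_max_right _ _).trans hk'
    have hk1 : (1 : ℝ) ≤ k := hY1.trans hkY
    have hkD : (k : ℝ) ≤ D * k := by nlinarith
    have hstep : D * (k : ℝ) ≤ D * ((k + 1 : ℕ) : ℝ) := by push_cast; nlinarith
    have hL := hY _ (hkY.trans hkD)
    have hPpos : 0 < ∏ i ∈ Finset.Icc 1 s, iterLog i (D * k) :=
      Finset.prod_pos fun i hi => by linarith [hL i (Finset.mem_Icc.1 hi).2]
    have h1 := iterLog_sub_iterLog_le hL hstep le_rfl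
    rw [prod_range_iterLog] at h1
    have h2 : ∀ m : Fin e → Fin k,
        ((D * k) ^ (e + 1) * ∏ i ∈ Finset.Icc 1 s, iterLog i (D * k))⁻¹ ≤ w (emb ⟨k, m⟩) := by
      intro m
      obtain ⟨hm1, hm2⟩ := hnorm k m
      refine le_trans ?_ (hw _ (hkX.trans hm1))
      have hLm := hY _ (hkY.trans hm1)
      have hPm : 0 < ∏ i ∈ Finset.Icc 1 s, iterLog i (latticeNorm (emb ⟨k, m⟩)) :=
        Finset.prod_pos fun i hi => by linarith [hLm i (Finset.mem_Icc.1 hi).2]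
      have hn0 : 0 < latticeNorm (emb ⟨k, m⟩) := by linarith
      apply inv_anti₀ (by positivity)
      refine mul_le_mul (by gcongr) ?_ hPm.le (by positivity)
      refine Finset.prod_le_prod (fun i hi => ?_) fun i hi => ?_
      · linarith [hLm i (Finset.mem_Icc.1 hi).2]
      · exact iterLog_le_iterLog hLm hm2 (by have := (Finset.mem_Icc.1 hi).2; omega)
    have h3 : (k : ℝ) ^ e * ((D * k) ^ (e + 1) * ∏ i ∈ Finset.Icc 1 s, iterLog i (D * k))⁻¹ ≤
        ∑ m : Fin e → Fin k, w (emb ⟨k, m⟩) := by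
      have := Finset.sum_le_sum fun m (_ : m ∈ Finset.univ) => h2 m
      simpa using this
    rw [Real.norm_of_nonneg (sub_nonneg.2 (iterLog_le_iterLog hL hstep le_rfl))]
    refine h1.trans ?_
    refine le_trans (le_of_eq ?_) (mul_le_mul_of_nonneg_left h3 (by positivity))
    have hk0 : (k : ℝ) ≠ 0 := by positivity
    push_cast
    field_simp
    ring
  have hlim := hasum.hasSum.tendsto_sum_nat
  simp only [ha, Finset.sum_range_sub (fun k : ℕ => iterLog (s + 1) (D * (k : ℝ)))] at hlim
  refine not_tendsto_nhds_of_tendsto_atTop ?_ _ hlim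
  refine tendsto_atTop_add_const_right _ _ ((tendsto_iterLog_atTop _).comp ?_)
  exact tendsto_natCast_atTop_atTop.const_mul_atTop (by linarith)

/-! ### A comparison principle from recurrence -/

theorem summable_inv_one_add_norm_pow (d : ℕ) :
    Summable fun n : Fin d → ℤ => ((1 + ‖n‖) ^ (d + 1))⁻¹ := by
  -- `ZLattice` sums over a submodule of a normed space; the sup norm on `ℝᵈ` fits the one on `ℤᵈ`.
  let L : Submodule ℤ (Fin d → ℝ) := Submodule.span ℤ (Set.range (Pi.basisFun ℝ (Fin d)))
  have hrank : Module.finrank ℤ L = d := by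
    have h := ZLattice.rank ℝ L
    simpa using h
  have hmem : ∀ n : Fin d → ℤ, (fun j => (n j : ℝ)) ∈ L := by
    intro n
    rw [Module.Basis.mem_span_iff_repr_mem ℤ (Pi.basisFun ℝ (Fin d))]
    intro j
    simp
  let emb : (Fin d → ℤ) → L := fun n => ⟨fun j => (n j : ℝ), hmem n⟩
  have hemb : Function.Injective emb := by
    intro n m h
    ext j
    have h1 : (n j : ℝ) = m j := congrFun (congrArg Subtype.val h) j
    exact_mod_cast h1
  have hnorm : ∀ n, ‖emb n‖ = ‖n‖ := by
    intro n
    change ‖(fun j => (n j : ℝ))‖ = ‖n‖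
    simp [Pi.norm_def]
    rfl
  have h := (ZLattice.summable_norm_zpow L (-((d : ℤ) + 1)) (by rw [hrank]; omega)).comp_injective
    hemb
  have h2 : Summable fun n : Fin d → ℤ => (‖n‖ ^ (d + 1))⁻¹ := by
    refine h.congr fun n => ?_
    rw [Function.comp_apply, hnorm, zpow_neg]
    norm_cast
  refine Summable.of_norm_bounded_eventually h2 ?_
  rw [Filter.eventually_cofinite]
  refine (Set.finite_singleton (0 : Fin d → ℤ)).subset fun n hn => ?_
  by_contra hne
  apply hn
  have hpos : 0 < ‖n‖ := norm_pos_iff.2 hne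
  rw [Real.norm_of_nonneg (by positivity)]
  gcongr
  linarith

theorem finite_setOf_norm_le {d : ℕ} (R : ℝ) : {n : Fin d → ℤ | ‖n‖ ≤ R}.Finite := by
  have h := (isCompact_closedBall (0 : Fin d → ℤ) R).finite_of_discrete
  refine h.subset fun n hn => ?_
  simpa using hn

theorem norm_latticeBasis {d : ℕ} (j : Fin d) : ‖latticeBasis j‖ = 1 := by
  simp [latticeBasis, Pi.norm_single]

/-- Comparison principle of recurrent type. If `b n ^ 2 = O((1 + ‖n‖) ^ (-d))`, the graph `ℤᵈ` with
edge weights `b n * b m` is recurrent: the cutoffs `max (1 - ‖n‖ / R) 0` have energy `O(1 / R)`.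
If moreover `u / b` is superharmonic for these weights outside a finite set, then `u / b` is bounded
below by its minimum `c` over that set and the origin: `g = max (c - u / b) 0` is bounded and
subharmonic, vanishes at the origin, and the
Caccioppoli inequality shows that it is constant. -/
theorem le_of_superharmonic_outside_finite {d : ℕ} {b u : (Fin d → ℤ) → ℝ} {C : ℝ}
    (hb : ∀ n, 0 < b n) (hbC : ∀ n, b n ^ 2 ≤ C * ((1 + ‖n‖) ^ d)⁻¹) (hu : ∀ n, 0 < u n)
    {K : Set (Fin d → ℤ)} (hK : K.Finite)
    (h : ∀ n ∉ K, b n * ∑ j, (u (n + latticeBasis j) + u (n - latticeBasis j)) ≤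
      u n * ∑ j, (b (n + latticeBasis j) + b (n - latticeBasis j))) :
    ∃ c, 0 < c ∧ ∀ n, c * b n ≤ u n := by
  -- Adding the point `0` makes the set nonempty, so that the minimum exists and `g` has a zero.
  obtain ⟨n₀, -, hn₀⟩ := Set.exists_min_image (insert 0 K) (fun n => u n / b n)
    (hK.insert 0) ⟨0, Set.mem_insert _ _⟩
  set c : ℝ := u n₀ / b n₀ with hc
  have hc0 : 0 < c := div_pos (hu _) (hb _)
  set g : (Fin d → ℤ) → ℝ := fun n => max (c - u n / b n) 0 with hg
  have hg0 : ∀ n, 0 ≤ g n := fun n => le_max_right _ _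
  have hgc : ∀ n, g n ≤ c := fun n =>
    max_le (by have := div_pos (hu n) (hb n); linarith) hc0.le
  have hgK : ∀ n ∈ insert 0 K, g n = 0 := fun n hn => max_eq_right (by linarith [hn₀ n hn])
  -- `g` is subharmonic for the weights `b n * b m`.
  have hsub : ∀ n, 0 ≤ g n * ∑ j, (b n * b (n + latticeBasis j) * (g (n + latticeBasis j) - g n) +
      b n * b (n - latticeBasis j) * (g (n - latticeBasis j) - g n)) := by
    intro n
    rcases (hg0 n).eq_or_lt with h0 | h0
    · rw [← h0, zero_mul]
    have hnK : n ∉ K := fun hn => h0.ne' (hgK n (Set.mem_insert_of_mem _ hn))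
    have hgn : g n = c - u n / b n := by
      rcases max_choice (c - u n / b n) 0 with h1 | h1
      · exact h1
      · exact absurd h1 h0.ne'
    have hm : ∀ m, b m * u n - b n * u m ≤ b n * b m * (g m - g n) := by
      intro m
      have h1 : c - u m / b m ≤ g m := le_max_left _ _
      have h2 : b m * u n - b n * u m = b n * b m * (u n / b n - u m / b m) := by
        have := (hb n).ne'
        have := (hb m).ne'
        field_simp
      rw [h2]
      exact mul_le_mul_of_nonneg_left (by linarith) (mul_pos (hb n) (hb m)).le
    refine mul_nonneg h0.le (le_trans ?_ (Finset.sum_le_sum fun j _ =>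
      add_le_add (hm (n + latticeBasis j)) (hm (n - latticeBasis j))))
    have h3 := h n hnK
    rw [Finset.mul_sum, Finset.mul_sum] at h3
    rw [← sub_nonneg, ← Finset.sum_sub_distrib] at h3
    refine h3.trans_eq (Finset.sum_congr rfl fun j _ => by ring)
  have hC0 : 0 ≤ C := by
    have h1 := hbC 0
    have h2 : 0 ≤ b 0 ^ 2 := sq_nonneg _
    simp at h1
    linarith
  have hstep : ∀ (n : Fin d → ℤ) (j : Fin d), |‖n + latticeBasis j‖ - ‖n‖| ≤ 1 := by
    intro n j
    have := abs_norm_sub_norm_le (n + latticeBasis j) n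
    rwa [add_sub_cancel_left, norm_latticeBasis] at this
  have hw : ∀ n (j : Fin d), b n * b (n + latticeBasis j) ≤ 2 ^ d * C * ((1 + ‖n‖) ^ d)⁻¹ := by
    intro n j
    have h1 := hbC n
    have h2 := hbC (n + latticeBasis j)
    have h3 : ((1 + ‖n + latticeBasis j‖) ^ d)⁻¹ ≤ 2 ^ d * ((1 + ‖n‖) ^ d)⁻¹ := by
      have h4 : (1 + ‖n‖) ≤ 2 * (1 + ‖n + latticeBasis j‖) := by
        have := (abs_le.1 (hstep n j)).1
        linarith [norm_nonneg n, norm_nonneg (n + latticeBasis j)]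
      have h5 : (1 + ‖n‖) ^ d ≤ 2 ^ d * (1 + ‖n + latticeBasis j‖) ^ d := by
        rw [← mul_pow]; gcongr
      rw [← div_eq_mul_inv, le_div_iff₀ (by positivity), inv_mul_le_iff₀ (by positivity)]
      linarith
    have h6 : ((1 + ‖n‖) ^ d)⁻¹ ≤ 2 ^ d * ((1 + ‖n‖) ^ d)⁻¹ :=
      le_mul_of_one_le_left (by positivity) (one_le_pow₀ (by norm_num))
    have h7 := mul_le_mul_of_nonneg_left h3 hC0
    have h8 := mul_le_mul_of_nonneg_left h6 hC0
    nlinarith [two_mul_le_add_sq (b n) (b (n + latticeBasis j))]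
  set S : ℝ := ∑' n : Fin d → ℤ, ((1 + ‖n‖) ^ (d + 1))⁻¹
  -- Cutoff at scale `R` and the resulting energy estimate.
  have henergy : ∀ (R : ℝ), 1 ≤ R → ∀ (n : Fin d → ℤ) (j : Fin d),
      b n * b (n + latticeBasis j) * (max (1 - ‖n + latticeBasis j‖ / R) 0 * g (n + latticeBasis j) -
        max (1 - ‖n‖ / R) 0 * g n) ^ 2 ≤ d * (c ^ 2 * (2 ^ d * C * 3) * S) / R := by
    intro R hR n j
    have hR0 : 0 < R := by linarith
    set χ : (Fin d → ℤ) → ℝ := fun n => max (1 - ‖n‖ / R) 0 with hχ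
    have hχ0 : ∀ n, R ≤ ‖n‖ → χ n = 0 := by
      intro n hn
      refine max_eq_right ?_
      rw [sub_nonpos, one_le_div hR0]
      exact hn
    have hχd : ∀ n (j : Fin d), (χ (n + latticeBasis j) - χ n) ^ 2 ≤ 3 / R * (1 + ‖n‖)⁻¹ := by
      intro n j
      by_cases hn : R + 1 ≤ ‖n‖
      · have h1 := (abs_le.1 (hstep n j)).1
        rw [hχ0 n (by linarith), hχ0 _ (by linarith), sub_zero, zero_pow two_ne_zero]
        positivity
      · push Not at hn
        have h1 : |χ (n + latticeBasis j) - χ n| ≤ 1 / R := by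
          refine (abs_max_sub_max_le_abs _ _ _).trans ?_
          rw [sub_sub_sub_cancel_left, ← sub_div, abs_div, abs_of_pos hR0, abs_sub_comm]
          gcongr
          exact hstep n j
        rw [← sq_abs]
        calc |χ (n + latticeBasis j) - χ n| ^ 2 ≤ (1 / R) ^ 2 := by gcongr
          _ ≤ 3 / R * (1 + ‖n‖)⁻¹ := by
            have h2 := norm_nonneg n
            rw [← div_eq_mul_inv, div_pow, le_div_iff₀ (by positivity), one_pow,
              div_mul_eq_mul_div, div_le_div_iff₀ (by positivity) hR0]
            nlinarith
    have hfin : ∀ (F : (Fin d → ℤ) → ℝ) (j : Fin d),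
        (∀ n, χ n = 0 → χ (n + latticeBasis j) = 0 → F n = 0) → Summable F := by
      intro F j hF
      apply summable_of_hasFiniteSupport
      refine (finite_setOf_norm_le (R + 1)).subset fun n hn => ?_
      by_contra hcon
      simp only [Set.mem_ofPred_eq, not_le] at hcon
      have h1 := (abs_le.1 (hstep n j)).1
      exact hn (hF n (hχ0 n (by linarith)) (hχ0 _ (by linarith)))
    set w : Fin d → (Fin d → ℤ) → ℝ := fun j n => b n * b (n + latticeBasis j)
    have hw0 : ∀ j n, 0 ≤ w j n := fun j n => (mul_pos (hb _) (hb _)).le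
    -- Up to a translation difference of `cr`, testing the subharmonicity of `g` with `χ ^ 2 * g`
    -- gives `P - Q`, by the identity
    -- `(g m - g n) (χ m² g m - χ n² g n) = (χ m g m - χ n g n)² - g n g m (χ m - χ n)²`.
    set cr : Fin d → (Fin d → ℤ) → ℝ := fun j n =>
      w j n * (g n - g (n + latticeBasis j)) * (χ (n + latticeBasis j) ^ 2 *
        g (n + latticeBasis j)) with hcr
    set P : Fin d → (Fin d → ℤ) → ℝ := fun j n =>
      w j n * (g n * g (n + latticeBasis j)) * (χ (n + latticeBasis j) - χ n) ^ 2 with hP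
    set Q : Fin d → (Fin d → ℤ) → ℝ := fun j n =>
      w j n * (χ (n + latticeBasis j) * g (n + latticeBasis j) - χ n * g n) ^ 2 with hQ
    have hcrs : ∀ j, Summable (cr j) := fun j => hfin _ j fun n h1 h2 => by simp [hcr, h2]
    have hPs : ∀ j, Summable (P j) := fun j => hfin _ j fun n h1 h2 => by simp [hP, h1, h2]
    have hQs : ∀ j, Summable (Q j) := fun j => hfin _ j fun n h1 h2 => by simp [hQ, h1, h2]
    have hsum := hasSum_sum (s := Finset.univ) fun (j : Fin d) _ =>
      ((hPs j).hasSum.sub (hQs j).hasSum).sub (hasSum_sub_translate (hcrs j) (latticeBasis j))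
    have hnonneg := hsum.nonneg fun n => by
      have h1 := mul_nonneg (sq_nonneg (χ n)) (hsub n)
      refine h1.trans_eq ?_
      rw [Finset.mul_sum, Finset.mul_sum]
      refine Finset.sum_congr rfl fun j _ => ?_
      simp only [hP, hQ, hcr, w, sub_add_cancel]
      ring
    simp only [sub_zero, Finset.sum_sub_distrib] at hnonneg
    have hPle : ∀ j, ∑' n, P j n ≤ c ^ 2 * (2 ^ d * C * 3) * S / R := by
      intro j
      have h1 : ∀ n, P j n ≤ c ^ 2 * (2 ^ d * C * 3) / R * ((1 + ‖n‖) ^ (d + 1))⁻¹ := by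
        intro n
        have h2 : g n * g (n + latticeBasis j) ≤ c * c :=
          mul_le_mul (hgc _) (hgc _) (hg0 _) hc0.le
        have h3 : w j n * (g n * g (n + latticeBasis j)) ≤
            2 ^ d * C * ((1 + ‖n‖) ^ d)⁻¹ * (c * c) :=
          mul_le_mul (hw n j) h2 (mul_nonneg (hg0 _) (hg0 _)) (by positivity)
        refine (mul_le_mul h3 (hχd n j) (sq_nonneg _) (by positivity)).trans_eq ?_
        rw [pow_succ (1 + ‖n‖), mul_inv]
        ring
      calc ∑' n, P j n ≤ ∑' n : Fin d → ℤ, c ^ 2 * (2 ^ d * C * 3) / R * ((1 + ‖n‖) ^ (d + 1))⁻¹ :=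
            (hPs j).tsum_le_tsum h1 ((summable_inv_one_add_norm_pow d).mul_left _)
        _ = _ := by rw [tsum_mul_left]; ring
    have hQ0 : ∀ j n, 0 ≤ Q j n := fun j n => mul_nonneg (hw0 j n) (sq_nonneg _)
    calc Q j n ≤ ∑' n, Q j n := (hQs j).le_tsum n fun m _ => hQ0 j m
      _ ≤ ∑ j, ∑' n, Q j n := Finset.single_le_sum (f := fun j => ∑' n, Q j n)
          (fun j _ => tsum_nonneg (hQ0 j)) (Finset.mem_univ j)
      _ ≤ ∑ j, ∑' n, P j n := by linarith
      _ ≤ ∑ _j : Fin d, c ^ 2 * (2 ^ d * C * 3) * S / R := Finset.sum_le_sum fun j _ => hPle j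
      _ = _ := by simp; ring
  have hconst : ∀ (n : Fin d → ℤ) (j : Fin d), g (n + latticeBasis j) = g n := by
    intro n j
    have hlim : ∀ m : Fin d → ℤ, Tendsto (fun R : ℝ => max (1 - ‖m‖ / R) 0) atTop (𝓝 1) := by
      intro m
      have h1 : Tendsto (fun R : ℝ => ‖m‖ / R) atTop (𝓝 0) :=
        tendsto_const_nhds.div_atTop tendsto_id
      have h2 := (h1.const_sub 1).max (tendsto_const_nhds (x := (0 : ℝ)))
      simpa using h2
    have h1 : Tendsto (fun R : ℝ => b n * b (n + latticeBasis j) *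
        (max (1 - ‖n + latticeBasis j‖ / R) 0 * g (n + latticeBasis j) -
        max (1 - ‖n‖ / R) 0 * g n) ^ 2) atTop
        (𝓝 (b n * b (n + latticeBasis j) * (1 * g (n + latticeBasis j) - 1 * g n) ^ 2)) :=
      ((((hlim _).mul_const _).sub ((hlim _).mul_const _)).pow 2).const_mul _
    have h2 : Tendsto (fun R : ℝ => d * (c ^ 2 * (2 ^ d * C * 3) * S) / R) atTop (𝓝 0) :=
      tendsto_const_nhds.div_atTop tendsto_id
    have h3 := le_of_tendsto_of_tendsto h1 h2
      ((eventually_ge_atTop 1).mono fun R hR => henergy R hR n j)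
    have h4 : 0 < b n * b (n + latticeBasis j) := mul_pos (hb _) (hb _)
    rw [one_mul, one_mul] at h3
    have h5 : (g (n + latticeBasis j) - g n) ^ 2 = 0 :=
      le_antisymm (by by_contra hcon; push Not at hcon; nlinarith [mul_pos h4 hcon]) (sq_nonneg _)
    exact sub_eq_zero.1 (pow_eq_zero_iff two_ne_zero |>.1 h5)
  have hall : ∀ n, g n = 0 := lattice_induction (P := fun n => g n = 0)
    (fun n j hn => (hconst n j).trans hn)
    (fun n j hn => by
      have := hconst (n - latticeBasis j) j
      rw [sub_add_cancel] at this
      exact this.symm.trans hn)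
    (hgK 0 (Set.mem_insert _ _))
  refine ⟨c, hc0, fun n => ?_⟩
  have h1 : c - u n / b n ≤ 0 := (le_max_left _ _).trans_eq (hall n)
  rw [sub_nonpos, le_div_iff₀ (hb n)] at h1
  exact h1

/-! ### The critical profile -/

theorem latticeNorm_sq {d : ℕ} (n : Fin d → ℤ) : latticeNorm n ^ 2 = ∑ j, (n j : ℝ) ^ 2 :=
  Real.sq_sqrt (Finset.sum_nonneg fun _ _ => sq_nonneg _)

theorem abs_apply_le_latticeNorm {d : ℕ} (n : Fin d → ℤ) (j : Fin d) :
    |(n j : ℝ)| ≤ latticeNorm n :=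
  Real.abs_le_sqrt (Finset.single_le_sum (f := fun j => (n j : ℝ) ^ 2)
    (fun _ _ => sq_nonneg _) (Finset.mem_univ j))

theorem norm_le_latticeNorm {d : ℕ} (n : Fin d → ℤ) : ‖n‖ ≤ latticeNorm n := by
  rw [pi_norm_le_iff_of_nonneg (latticeNorm_nonneg n)]
  intro j
  rw [Int.norm_eq_abs]
  exact abs_apply_le_latticeNorm n j

theorem latticeNorm_add_basis_sq {d : ℕ} (n : Fin d → ℤ) (j : Fin d) :
    latticeNorm (n + latticeBasis j) ^ 2 = latticeNorm n ^ 2 + (2 * n j + 1) := by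
  have h : ∀ i, ((n + latticeBasis j) i : ℝ) ^ 2 =
      (n i : ℝ) ^ 2 + if i = j then (2 * (n j : ℝ) + 1) else 0 := by
    intro i
    by_cases hi : i = j
    · subst hi
      simp [latticeBasis]
      ring
    · simp [latticeBasis, hi]
  rw [latticeNorm_sq, latticeNorm_sq, Finset.sum_congr rfl fun i _ => h i,
    Finset.sum_add_distrib]
  simp

theorem latticeNorm_sub_basis_sq {d : ℕ} (n : Fin d → ℤ) (j : Fin d) :
    latticeNorm (n - latticeBasis j) ^ 2 = latticeNorm n ^ 2 + (-2 * n j + 1) := by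
  have h := latticeNorm_add_basis_sq (n - latticeBasis j) j
  rw [sub_add_cancel] at h
  have h2 : ((n - latticeBasis j) j : ℝ) = n j - 1 := by simp [latticeBasis]
  rw [h2] at h
  linarith

theorem latticeNorm_sub_one_le_add_basis {d : ℕ} (n : Fin d → ℤ) (j : Fin d) :
    latticeNorm n - 1 ≤ latticeNorm (n + latticeBasis j) := by
  refine le_of_abs_le (abs_le_of_sq_le_sq ?_ (latticeNorm_nonneg _))
  have h := latticeNorm_add_basis_sq n j
  have h2 := (abs_le.1 (abs_apply_le_latticeNorm n j)).1
  nlinarith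

theorem latticeNorm_sub_one_le_sub_basis {d : ℕ} (n : Fin d → ℤ) (j : Fin d) :
    latticeNorm n - 1 ≤ latticeNorm (n - latticeBasis j) := by
  refine le_of_abs_le (abs_le_of_sq_le_sq ?_ (latticeNorm_nonneg _))
  have h := latticeNorm_sub_basis_sq n j
  have h2 := (abs_le.1 (abs_apply_le_latticeNorm n j)).2
  nlinarith

/-- The radial profile `r ^ (-d/2) ∏ᵢ (logᵢ r) ^ (-1/2)`, `1 ≤ i ≤ s`. Its square is the borderline
non-summable weight on `ℤᵈ`. It is meaningful only where all the iterated logarithms are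
positive. -/
noncomputable def criticalProfile (d s : ℕ) (r : ℝ) : ℝ :=
  r ^ (-((d : ℝ) / 2)) * ∏ i ∈ Finset.Icc 1 s, (Real.sqrt (iterLog i r))⁻¹

theorem pos_of_one_le_iterLog {s : ℕ} {r : ℝ} (hr : ∀ i ≤ s, 1 ≤ iterLog i r) : 0 < r :=
  zero_lt_one.trans_le (hr 0 (Nat.zero_le _))

theorem criticalProfile_pos {d s : ℕ} {r : ℝ} (hr : ∀ i ≤ s, 1 ≤ iterLog i r) :
    0 < criticalProfile d s r := by
  have hr0 : 0 < r := pos_of_one_le_iterLog hr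
  refine mul_pos (Real.rpow_pos_of_pos hr0 _) (Finset.prod_pos fun i hi => ?_)
  exact inv_pos.2 (Real.sqrt_pos.2 (by linarith [hr i (Finset.mem_Icc.1 hi).2]))

theorem criticalProfile_sq {d s : ℕ} {r : ℝ} (hr : ∀ i ≤ s, 1 ≤ iterLog i r) :
    criticalProfile d s r ^ 2 = (r ^ d * ∏ i ∈ Finset.Icc 1 s, iterLog i r)⁻¹ := by
  have hr0 : 0 < r := pos_of_one_le_iterLog hr
  rw [criticalProfile, mul_pow, mul_inv, ← Finset.prod_pow, ← Finset.prod_inv_distrib]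
  congr 1
  · rw [← Real.rpow_natCast (_ ^ _) 2, ← Real.rpow_mul hr0.le, ← Real.rpow_natCast r d,
      ← Real.rpow_neg hr0.le]
    congr 1
    push_cast
    ring
  · refine Finset.prod_congr rfl fun i hi => ?_
    rw [inv_pow, Real.sq_sqrt (by linarith [hr i (Finset.mem_Icc.1 hi).2])]

/-- The quotient of the values of `criticalProfile d s` at `ρ` and at `r`. -/
noncomputable def profileRatio (d s : ℕ) (r ρ : ℝ) : ℝ :=
  (r / ρ) ^ ((d : ℝ) / 2) * ∏ i ∈ Finset.Icc 1 s, Real.sqrt (iterLog i r / iterLog i ρ)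

theorem criticalProfile_eq_mul {d s : ℕ} {r ρ : ℝ} (hr : ∀ i ≤ s, 1 ≤ iterLog i r)
    (hρ : ∀ i ≤ s, 1 ≤ iterLog i ρ) :
    criticalProfile d s ρ = criticalProfile d s r * profileRatio d s r ρ := by
  have hr0 : 0 < r := pos_of_one_le_iterLog hr
  have hρ0 : 0 < ρ := pos_of_one_le_iterLog hρ
  rw [criticalProfile, criticalProfile, profileRatio, mul_mul_mul_comm, ← Finset.prod_mul_distrib]
  congr 1
  · rw [Real.div_rpow hr0.le hρ0.le, Real.rpow_neg hr0.le, Real.rpow_neg hρ0.le]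
    have := (Real.rpow_pos_of_pos hr0 ((d : ℝ) / 2)).ne'
    field_simp
  · refine Finset.prod_congr rfl fun i hi => ?_
    have h1 : 0 < iterLog i r := by linarith [hr i (Finset.mem_Icc.1 hi).2]
    have h2 := (Real.sqrt_pos.2 h1).ne'
    rw [Real.sqrt_div h1.le]
    field_simp

/-- The criterion in terms of the critical profile. A positive ground state would dominate a
multiple of the profile, which is not square-summable. -/
theorem no_ground_state_of_le_ratio {d : ℕ} (hd : 1 ≤ d) {V : (Fin d → ℤ) → ℝ} {s : ℕ} {N : ℝ}
    (hV : ∀ n : Fin d → ℤ, N ≤ latticeNorm n →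
        V n ≤ -2 * (d : ℝ) + ∑ j : Fin d,
          (profileRatio d s (latticeNorm n) (latticeNorm (n + latticeBasis j)) +
            profileRatio d s (latticeNorm n) (latticeNorm (n - latticeBasis j)))) :
    0 ∉ pmapPointSpectrum (schrodinger V) ∨ 0 ≠ infSpectrum (schrodinger V) := by
  by_contra hcon
  push Not at hcon
  obtain ⟨u, hu0, husum, hu⟩ := exists_pos_ground_state hcon.1 hcon.2
  obtain ⟨X, hX1, hX⟩ := exists_forall_one_le_iterLog s
  classical
  -- The profile is replaced by `1` near the origin, where the iterated logarithms are not positive.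
  set b : (Fin d → ℤ) → ℝ := fun n =>
    if X ≤ latticeNorm n then criticalProfile d s (latticeNorm n) else 1 with hb
  have hbX : ∀ n, X ≤ latticeNorm n → b n = criticalProfile d s (latticeNorm n) :=
    fun n hn => if_pos hn
  have hb0 : ∀ n, 0 < b n := by
    intro n
    by_cases hn : X ≤ latticeNorm n
    · rw [hbX n hn]
      exact criticalProfile_pos (hX _ hn)
    · simp only [hb, if_neg hn, zero_lt_one]
  have hbC : ∀ n, b n ^ 2 ≤ (2 ^ d + (X + 1) ^ d) * ((1 + ‖n‖) ^ d)⁻¹ := by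
    intro n
    have hn0 := norm_nonneg n
    have hle := norm_le_latticeNorm n
    rw [← div_eq_mul_inv, le_div_iff₀ (by positivity)]
    by_cases hn : X ≤ latticeNorm n
    · rw [hbX n hn, criticalProfile_sq (hX _ hn)]
      have hr0 : 0 < latticeNorm n := by linarith
      have h1 : (1 : ℝ) ≤ ∏ i ∈ Finset.Icc 1 s, iterLog i (latticeNorm n) := by
        refine Finset.prod_induction _ (fun x => (1 : ℝ) ≤ x)
          (fun a b ha hb => one_le_mul_of_one_le_of_one_le ha hb) le_rfl fun i hi => ?_
        exact hX _ hn i (Finset.mem_Icc.1 hi).2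
      have h2 : (1 + ‖n‖) ^ d ≤ 2 ^ d * latticeNorm n ^ d := by
        rw [← mul_pow]
        gcongr
        linarith
      have h3 : (0 : ℝ) ≤ (X + 1) ^ d := by positivity
      rw [inv_mul_le_iff₀ (by positivity)]
      have h4 : latticeNorm n ^ d ≤
          latticeNorm n ^ d * ∏ i ∈ Finset.Icc 1 s, iterLog i (latticeNorm n) :=
        le_mul_of_one_le_right (by positivity) h1
      calc (1 + ‖n‖) ^ d ≤ latticeNorm n ^ d * 2 ^ d := by linarith
        _ ≤ _ := mul_le_mul h4 (by linarith) (by positivity) (by positivity)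
    · simp only [hb, if_neg hn, one_pow, one_mul]
      push Not at hn
      have h2 : (1 + ‖n‖) ^ d ≤ (X + 1) ^ d := by
        gcongr ?_ ^ d
        linarith
      have h3 : (0 : ℝ) ≤ 2 ^ d := by positivity
      linarith
  have hK : {n : Fin d → ℤ | latticeNorm n < max N (X + 1)}.Finite :=
    (finite_setOf_norm_le (max N (X + 1))).subset fun n hn =>
      (norm_le_latticeNorm n).trans (le_of_lt hn)
  obtain ⟨c, hc0, hc⟩ := le_of_superharmonic_outside_finite hb0 hbC hu0 hK (by
    intro n hn
    simp only [Set.mem_ofPred_eq, not_lt] at hn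
    have hnN := (le_max_left _ _).trans hn
    have hnX := (le_max_right _ _).trans hn
    have hnX' : X ≤ latticeNorm n := by linarith
    have hadd : ∀ j, X ≤ latticeNorm (n + latticeBasis j) := fun j => by
      linarith [latticeNorm_sub_one_le_add_basis n j]
    have hsub : ∀ j, X ≤ latticeNorm (n - latticeBasis j) := fun j => by
      linarith [latticeNorm_sub_one_le_sub_basis n j]
    have hsum : ∑ j, (b (n + latticeBasis j) + b (n - latticeBasis j)) = b n * ∑ j : Fin d,
          (profileRatio d s (latticeNorm n) (latticeNorm (n + latticeBasis j)) +
            profileRatio d s (latticeNorm n) (latticeNorm (n - latticeBasis j))) := by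
      rw [Finset.mul_sum]
      refine Finset.sum_congr rfl fun j _ => ?_
      rw [hbX _ (hadd j), hbX _ (hsub j), hbX n hnX', mul_add,
        criticalProfile_eq_mul (hX _ hnX') (hX _ (hadd j)),
        criticalProfile_eq_mul (hX _ hnX') (hX _ (hsub j))]
    rw [hu, hsum]
    have h1 := hV n hnN
    have h2 := mul_pos (hb0 n) (hu0 n)
    nlinarith)
  refine not_summable_of_critical_le (w := fun n => b n ^ 2) hd s (fun n => sq_nonneg _) (X := X)
    (fun n hn => ?_) ?_
  · rw [hbX n hn, criticalProfile_sq (hX _ hn)]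
  · refine Summable.of_nonneg_of_le (fun n => sq_nonneg _) (fun n => ?_)
      (husum.mul_left (c ^ 2)⁻¹)
    rw [← div_eq_inv_mul, le_div_iff₀ (by positivity), mul_comm, ← mul_pow]
    have := mul_pos hc0 (hb0 n)
    exact pow_le_pow_left₀ this.le (hc n) 2

/-! ### Uniform expansions of iterated logarithms -/

/-- Second-order expansions `a t + b t² + O(t³)` with bounded varying coefficients are preserved by
composition with a function of the form `z + k z² + O(z³)`. -/
theorem isBigO_expansion_comp {α : Type*} {l : Filter α} {φ : ℝ → ℝ} {k : ℝ}
    (hφ : (fun z => φ z - (z + k * z ^ 2)) =O[𝓝 0] fun z => z ^ 3) {f a b t : α → ℝ}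
    (ht : Tendsto t l (𝓝 0)) (ha : a =O[l] fun _ => (1 : ℝ)) (hb : b =O[l] fun _ => (1 : ℝ))
    (hf : (fun x => f x - (a x * t x + b x * t x ^ 2)) =O[l] fun x => t x ^ 3) :
    (fun x => φ (f x) - (a x * t x + (b x + k * a x ^ 2) * t x ^ 2)) =O[l] fun x => t x ^ 3 := by
  have ht1 : t =O[l] fun _ => (1 : ℝ) := ht.isBigO_one ℝ
  have ht32 : (fun x => t x ^ 3) =O[l] fun x => t x ^ 2 := by
    refine ((isBigO_refl (fun x => t x ^ 2) l).mul ht1).congr (fun x => ?_) fun x => ?_ <;> ring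
  have ht21 : (fun x => t x ^ 2) =O[l] t := by
    refine ((isBigO_refl t l).mul ht1).congr (fun x => ?_) fun x => ?_ <;> ring
  have hat : (fun x => a x * t x) =O[l] t := by
    refine (ha.mul (isBigO_refl t l)).congr (fun x => rfl) fun x => ?_
    ring
  have hbt : (fun x => b x * t x ^ 2) =O[l] fun x => t x ^ 2 := by
    refine (hb.mul (isBigO_refl (fun x => t x ^ 2) l)).congr (fun x => rfl) fun x => ?_
    ring
  have hfat : (fun x => f x - a x * t x) =O[l] fun x => t x ^ 2 := by
    refine ((hf.trans ht32).add hbt).congr_left fun x => ?_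
    ring
  have hft : f =O[l] t := by
    refine ((hfat.trans ht21).add hat).congr_left fun x => ?_
    ring
  have hf0 : Tendsto f l (𝓝 0) := hft.trans_tendsto ht
  have h1 : (fun x => φ (f x) - (f x + k * f x ^ 2)) =O[l] fun x => t x ^ 3 :=
    (hφ.comp_tendsto hf0).trans (hft.pow 3)
  have h2 : (fun x => (f x - a x * t x) * (f x + a x * t x)) =O[l] fun x => t x ^ 3 := by
    refine (hfat.mul (hft.add hat)).congr_right fun x => ?_
    ring
  refine ((h1.add hf).add (h2.const_mul_left k)).congr_left fun x => ?_
  ring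

theorem log_one_add_expansion :
    (fun z => Real.log (1 + z) - (z + (-1 / 2) * z ^ 2)) =O[𝓝 0] fun z => z ^ 3 := by
  refine IsBigO.of_bound 2 ?_
  filter_upwards [Metric.ball_mem_nhds (0 : ℝ) (ε := 1 / 2) (by norm_num)] with z hz
  rw [Metric.mem_ball, Real.dist_eq, sub_zero] at hz
  have h := Real.abs_log_sub_add_sum_range_le (x := -z) (by rw [abs_neg]; linarith) 2
  rw [abs_neg] at h
  simp only [Finset.sum_range_succ, Finset.sum_range_zero, sub_neg_eq_add] at h
  rw [Real.norm_eq_abs, Real.norm_eq_abs, abs_pow]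
  calc |Real.log (1 + z) - (z + (-1 / 2) * z ^ 2)| ≤ |z| ^ 3 / (1 - |z|) := by
        convert h using 2
        push_cast
        ring
    _ ≤ 2 * |z| ^ 3 := by
        rw [div_le_iff₀ (by linarith)]
        have : 0 ≤ |z| ^ 3 := by positivity
        nlinarith

theorem exp_sub_one_expansion :
    (fun z => (Real.exp z - 1) - (z + (1 / 2) * z ^ 2)) =O[𝓝 0] fun z => z ^ 3 := by
  refine (Real.exp_sub_sum_range_isBigO_pow 3).congr_left fun z => ?_
  simp [Finset.sum_range_succ, Nat.factorial]
  ring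

/-- The product `Pᵢ = ∏ₖ 1 / logₖ x` over `1 ≤ k ≤ i`. -/
noncomputable def logWeight (i : ℕ) (x : ℝ) : ℝ := ∏ k ∈ Finset.Icc 1 i, 1 / iterLog k x

/-- The sum `P₁ + ⋯ + Pₛ` of the products `logWeight`. -/
noncomputable def logWeightSum (s : ℕ) (x : ℝ) : ℝ := ∑ j ∈ Finset.Icc 1 s, logWeight j x

/-- The quadratic sum `∑ Pᵢ Pⱼ` over `1 ≤ i ≤ j ≤ s` of the products `logWeight`. -/
noncomputable def logWeightQuad (s : ℕ) (x : ℝ) : ℝ :=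
  ∑ j ∈ Finset.Icc 1 s, logWeight j x * logWeightSum j x

theorem logWeight_zero (x : ℝ) : logWeight 0 x = 1 := by simp [logWeight]

theorem logWeight_succ (i : ℕ) (x : ℝ) :
    logWeight (i + 1) x = logWeight i x / iterLog (i + 1) x := by
  rw [logWeight, Finset.prod_Icc_succ_top (by omega), logWeight, mul_one_div]

theorem logWeightSum_succ (s : ℕ) (x : ℝ) :
    logWeightSum (s + 1) x = logWeightSum s x + logWeight (s + 1) x := by
  rw [logWeightSum, Finset.sum_Icc_succ_top (by omega), logWeightSum]

theorem sq_logWeightSum_le (s : ℕ) (x : ℝ) : logWeightSum s x ^ 2 ≤ 2 * logWeightQuad s x := by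
  induction s with
  | zero => simp [logWeightSum, logWeightQuad]
  | succ s ih =>
    have h : logWeightQuad (s + 1) x =
        logWeightQuad s x + logWeight (s + 1) x * logWeightSum (s + 1) x := by
      rw [logWeightQuad, Finset.sum_Icc_succ_top (by omega), logWeightQuad]
    rw [h, logWeightSum_succ]
    nlinarith [sq_nonneg (logWeight (s + 1) x)]

theorem isBigO_inv_iterLog (i : ℕ) : (fun x => 1 / iterLog i x) =O[atTop] fun _ => (1 : ℝ) := by
  refine IsBigO.of_bound 1 ?_
  filter_upwards [(tendsto_iterLog_atTop i).eventually_ge_atTop 1] with x hx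
  rw [norm_one, mul_one, Real.norm_of_nonneg (by positivity)]
  exact (div_le_one (by linarith)).2 hx

theorem isBigO_logWeight (i : ℕ) : logWeight i =O[atTop] fun _ => (1 : ℝ) := by
  induction i with
  | zero => exact (isBigO_refl (fun _ => (1 : ℝ)) _).congr_left fun x => (logWeight_zero x).symm
  | succ i ih =>
    refine (ih.mul (isBigO_inv_iterLog (i + 1))).congr (fun x => ?_) fun x => one_mul _
    rw [logWeight_succ, mul_one_div]

theorem isBigO_logWeightSum (s : ℕ) : logWeightSum s =O[atTop] fun _ => (1 : ℝ) :=
  IsBigO.fun_sum fun i _ => isBigO_logWeight i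

theorem isBigO_logWeightQuad (s : ℕ) : logWeightQuad s =O[atTop] fun _ => (1 : ℝ) :=
  IsBigO.fun_sum fun i _ =>
    ((isBigO_logWeight i).mul (isBigO_logWeightSum i)).congr_right fun _ => one_mul _

theorem isBigO_fst {f : ℝ → ℝ} (hf : f =O[atTop] fun _ => (1 : ℝ)) :
    (fun p : ℝ × ℝ => f p.1) =O[atTop ×ˢ 𝓝 0] fun _ => (1 : ℝ) :=
  hf.comp_tendsto tendsto_fst

theorem tendsto_mul_sqrt_one_add :
    Tendsto (fun p : ℝ × ℝ => p.1 * Real.sqrt (1 + p.2)) (atTop ×ˢ 𝓝 0) atTop := by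
  have h1 : Tendsto (fun p : ℝ × ℝ => Real.sqrt (1 + p.2)) (atTop ×ˢ 𝓝 0) (𝓝 1) := by
    have h : Tendsto (fun t : ℝ => Real.sqrt (1 + t)) (𝓝 0) (𝓝 1) := by
      have : Continuous fun t : ℝ => Real.sqrt (1 + t) := by fun_prop
      simpa using this.tendsto 0
    exact h.comp tendsto_snd
  exact tendsto_fst.atTop_mul_pos one_pos h1

/-- Expansion of the increment of an iterated logarithm from `x` to `x √(1 + t)`, uniformly as
`x → ∞` and `t → 0`, by induction through
`log_{i+2} y - log_{i+2} x = log (1 + (log_{i+1} y - log_{i+1} x) / log_{i+1} x)`. -/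
theorem iterLog_sub_expansion (i : ℕ) :
    (fun p : ℝ × ℝ => (iterLog (i + 1) (p.1 * Real.sqrt (1 + p.2)) - iterLog (i + 1) p.1) -
      (logWeight i p.1 / 2 * p.2 +
        -(logWeight i p.1 / 4 + logWeight i p.1 * logWeightSum i p.1 / 8) * p.2 ^ 2))
      =O[atTop ×ˢ 𝓝 0] fun p => p.2 ^ 3 := by
  induction i with
  | zero =>
    have h := (log_one_add_expansion.comp_tendsto
      (tendsto_snd (f := (atTop : Filter ℝ)) (g := 𝓝 (0 : ℝ)))).const_mul_left (1 / 2)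
    refine h.congr' ?_ EventuallyEq.rfl
    have hp : ∀ᶠ p : ℝ × ℝ in atTop ×ˢ 𝓝 0, 0 < p.1 :=
      tendsto_fst.eventually (eventually_gt_atTop 0)
    have ht : ∀ᶠ p : ℝ × ℝ in atTop ×ˢ 𝓝 0, -1 < p.2 :=
      tendsto_snd.eventually (eventually_gt_nhds (by norm_num))
    filter_upwards [hp, ht] with p hp ht
    have h1 : 0 < 1 + p.2 := by linarith
    simp only [Function.comp_apply, iterLog_succ, logWeight_zero]
    simp only [iterLog, Function.iterate_zero, id, logWeightSum]
    rw [Real.log_mul hp.ne' (Real.sqrt_pos.2 h1).ne', Real.log_sqrt h1.le]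
    simp
    ring
  | succ i ih =>
    have hL := isBigO_fst (isBigO_inv_iterLog (i + 1))
    have hP := isBigO_fst (isBigO_logWeight i)
    have hP' := isBigO_fst (isBigO_logWeight (i + 1))
    have hT := isBigO_fst (isBigO_logWeightSum i)
    have hf := (ih.mul hL).congr_right fun p => mul_one (p.2 ^ 3)
    have hb : (fun p : ℝ × ℝ => -(logWeight i p.1 / 4 +
        logWeight i p.1 * logWeightSum i p.1 / 8) * (1 / iterLog (i + 1) p.1))
        =O[atTop ×ˢ 𝓝 0] fun _ => (1 : ℝ) := by
      have h1 := ((hP.const_mul_left (1 / 4)).add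
        (((hP.mul hT).congr_right fun _ => one_mul (1 : ℝ)).const_mul_left (1 / 8))).neg_left
      refine (h1.mul hL).congr (fun p => ?_) fun _ => one_mul _
      ring
    have ha : (fun p : ℝ × ℝ => logWeight i p.1 / 2 * (1 / iterLog (i + 1) p.1))
        =O[atTop ×ˢ 𝓝 0] fun _ => (1 : ℝ) := by
      refine ((hP.const_mul_left (1 / 2)).mul hL).congr (fun p => ?_) fun _ => one_mul _
      ring
    have h := isBigO_expansion_comp log_one_add_expansion
      (f := fun p : ℝ × ℝ => (iterLog (i + 1) (p.1 * Real.sqrt (1 + p.2)) - iterLog (i + 1) p.1) *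
        (1 / iterLog (i + 1) p.1)) (t := Prod.snd) tendsto_snd ha hb
      (hf.congr_left fun p => by ring)
    refine h.congr' ?_ EventuallyEq.rfl
    have h1 : ∀ᶠ p : ℝ × ℝ in atTop ×ˢ 𝓝 0, 0 < iterLog (i + 1) p.1 :=
      tendsto_fst.eventually ((tendsto_iterLog_atTop (i + 1)).eventually_gt_atTop 0)
    have h2 : ∀ᶠ p : ℝ × ℝ in atTop ×ˢ 𝓝 0,
        0 < iterLog (i + 1) (p.1 * Real.sqrt (1 + p.2)) :=
      tendsto_mul_sqrt_one_add.eventually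
        ((tendsto_iterLog_atTop (i + 1)).eventually_gt_atTop 0)
    filter_upwards [h1, h2] with p h1 h2
    rw [iterLog_succ (i + 1), iterLog_succ (i + 1), ← Real.log_div h2.ne' h1.ne',
      logWeightSum_succ, logWeight_succ]
    have h3 : 1 + (iterLog (i + 1) (p.1 * Real.sqrt (1 + p.2)) - iterLog (i + 1) p.1) *
        (1 / iterLog (i + 1) p.1) =
        iterLog (i + 1) (p.1 * Real.sqrt (1 + p.2)) / iterLog (i + 1) p.1 := by
      field_simp
      ring
    rw [h3]
    field_simp
    ring

theorem profileRatio_eq_exp {d s : ℕ} {r ρ : ℝ} (hr : ∀ i ≤ s, 1 ≤ iterLog i r)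
    (hρ : ∀ i ≤ s, 1 ≤ iterLog i ρ) :
    profileRatio d s r ρ = Real.exp (-(d / 2) * (iterLog 1 ρ - iterLog 1 r) +
      ∑ i ∈ Finset.Icc 1 s, -(1 / 2) * (iterLog (i + 1) ρ - iterLog (i + 1) r)) := by
  have hr0 := pos_of_one_le_iterLog hr
  have hρ0 := pos_of_one_le_iterLog hρ
  rw [profileRatio, Real.exp_add, Real.exp_sum]
  congr 1
  · rw [Real.rpow_def_of_pos (div_pos hr0 hρ0), Real.log_div hr0.ne' hρ0.ne']
    simp only [iterLog, Function.iterate_one]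
    congr 1
    ring
  · refine Finset.prod_congr rfl fun i hi => ?_
    have h1 : 0 < iterLog i r := by linarith [hr i (Finset.mem_Icc.1 hi).2]
    have h2 : 0 < iterLog i ρ := by linarith [hρ i (Finset.mem_Icc.1 hi).2]
    rw [Real.sqrt_eq_rpow, Real.rpow_def_of_pos (div_pos h1 h2), Real.log_div h1.ne' h2.ne',
      iterLog_succ, iterLog_succ]
    congr 1
    ring

/-- Expansion of the profile quotient in the relative change `t` of the squared radius. -/
theorem profileRatio_expansion (d s : ℕ) :
    (fun p : ℝ × ℝ => (profileRatio d s p.1 (p.1 * Real.sqrt (1 + p.2)) - 1) -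
      (-(d + logWeightSum s p.1) / 4 * p.2 +
        ((d + logWeightSum s p.1) / 8 + logWeightQuad s p.1 / 16 +
          1 / 2 * (-(d + logWeightSum s p.1) / 4) ^ 2) * p.2 ^ 2))
      =O[atTop ×ˢ 𝓝 0] fun p => p.2 ^ 3 := by
  have h0 := (iterLog_sub_expansion 0).const_mul_left (-(d / 2 : ℝ))
  have hs : (fun p : ℝ × ℝ => ∑ i ∈ Finset.Icc 1 s, (-(1 / 2) : ℝ) *
      ((iterLog (i + 1) (p.1 * Real.sqrt (1 + p.2)) - iterLog (i + 1) p.1) -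
      (logWeight i p.1 / 2 * p.2 +
        -(logWeight i p.1 / 4 + logWeight i p.1 * logWeightSum i p.1 / 8) * p.2 ^ 2)))
      =O[atTop ×ˢ 𝓝 0] fun p => p.2 ^ 3 :=
    IsBigO.fun_sum fun i _ => (iterLog_sub_expansion i).const_mul_left (-(1 / 2))
  have hT := isBigO_fst (isBigO_logWeightSum s)
  have hU := isBigO_fst (isBigO_logWeightQuad s)
  have hd : (fun _ : ℝ × ℝ => (d : ℝ)) =O[atTop ×ˢ 𝓝 0] fun _ => (1 : ℝ) :=
    isBigO_const_const _ one_ne_zero _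
  have ha : (fun p : ℝ × ℝ => -(d + logWeightSum s p.1) / 4)
      =O[atTop ×ˢ 𝓝 0] fun _ => (1 : ℝ) :=
    ((hd.add hT).const_mul_left (-1 / 4)).congr_left fun p => by ring
  have hb : (fun p : ℝ × ℝ => (d + logWeightSum s p.1) / 8 + logWeightQuad s p.1 / 16)
      =O[atTop ×ˢ 𝓝 0] fun _ => (1 : ℝ) :=
    (((hd.add hT).const_mul_left (1 / 8)).add (hU.const_mul_left (1 / 16))).congr_left
      fun p => by ring
  have h := isBigO_expansion_comp exp_sub_one_expansion
    (f := fun p : ℝ × ℝ => -(d / 2) * (iterLog 1 (p.1 * Real.sqrt (1 + p.2)) - iterLog 1 p.1) +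
      ∑ i ∈ Finset.Icc 1 s, -(1 / 2) *
        (iterLog (i + 1) (p.1 * Real.sqrt (1 + p.2)) - iterLog (i + 1) p.1))
    (t := Prod.snd) tendsto_snd ha hb ((h0.add hs).congr_left fun p => by
      have e1 : ∑ i ∈ Finset.Icc 1 s, (-(1 / 2) : ℝ) *
          ((iterLog (i + 1) (p.1 * Real.sqrt (1 + p.2)) - iterLog (i + 1) p.1) -
          (logWeight i p.1 / 2 * p.2 +
            -(logWeight i p.1 / 4 + logWeight i p.1 * logWeightSum i p.1 / 8) * p.2 ^ 2)) =
          ∑ i ∈ Finset.Icc 1 s, (-(1 / 2) : ℝ) *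
            (iterLog (i + 1) (p.1 * Real.sqrt (1 + p.2)) - iterLog (i + 1) p.1) +
          (logWeightSum s p.1 * (p.2 / 4 - p.2 ^ 2 / 8) - logWeightQuad s p.1 * p.2 ^ 2 / 16) := by
        simp only [logWeightSum, logWeightQuad, Finset.sum_mul, Finset.sum_div]
        rw [← Finset.sum_sub_distrib, ← Finset.sum_add_distrib]
        refine Finset.sum_congr rfl fun i _ => ?_
        ring
      rw [e1, logWeight_zero]
      simp only [zero_add, logWeightSum, Finset.Icc_eq_empty_of_lt zero_lt_one, Finset.sum_empty]
      ring)
  obtain ⟨X, -, hX⟩ := exists_forall_one_le_iterLog s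
  refine h.congr' ?_ EventuallyEq.rfl
  filter_upwards [tendsto_fst.eventually (eventually_ge_atTop X),
    tendsto_mul_sqrt_one_add.eventually (eventually_ge_atTop X)] with p h1 h2
  rw [profileRatio_eq_exp (hX _ h1) (hX _ h2)]

/-! ### The discrete Laplacian of the critical profile -/

/-- The expansion of the profile quotient from `|n|` to a radius `ρ n` with
`ρ n ^ 2 = |n| ^ 2 + e n` and `e n = O(|n|)`, as for the neighbours of `n`. -/
theorem profileRatio_lattice_expansion {d : ℕ} (s : ℕ) {e ρ : (Fin d → ℤ) → ℝ}
    (he : ∀ n, |e n| ≤ 2 * latticeNorm n + 1) (hρ0 : ∀ n, 0 ≤ ρ n)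
    (hρ : ∀ n, ρ n ^ 2 = latticeNorm n ^ 2 + e n) :
    (fun n => (profileRatio d s (latticeNorm n) (ρ n) - 1) -
      (-(d + logWeightSum s (latticeNorm n)) / 4 * (e n / latticeNorm n ^ 2) +
        ((d + logWeightSum s (latticeNorm n)) / 8 + logWeightQuad s (latticeNorm n) / 16 +
          1 / 2 * (-(d + logWeightSum s (latticeNorm n)) / 4) ^ 2) *
          (e n / latticeNorm n ^ 2) ^ 2))
      =O[comap latticeNorm atTop] fun n => ((latticeNorm n)⁻¹) ^ 3 := by
  have htend : Tendsto (latticeNorm (d := d)) (comap latticeNorm atTop) atTop := tendsto_comap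
  have hO : (fun n : Fin d → ℤ => e n / latticeNorm n ^ 2)
      =O[comap latticeNorm atTop] fun n => (latticeNorm n)⁻¹ := by
    refine IsBigO.of_bound 3 ?_
    filter_upwards [htend.eventually_ge_atTop 1] with n hn
    have hpos : 0 < latticeNorm n := by linarith
    rw [Real.norm_eq_abs, abs_div, abs_of_pos (pow_pos hpos 2), Real.norm_of_nonneg (by positivity),
      div_le_iff₀ (by positivity)]
    have : 3 * (latticeNorm n)⁻¹ * latticeNorm n ^ 2 = 3 * latticeNorm n := by field_simp
    rw [this]
    linarith [he n]
  have ht0 : Tendsto (fun n : Fin d → ℤ => e n / latticeNorm n ^ 2) (comap latticeNorm atTop)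
      (𝓝 0) := hO.trans_tendsto (tendsto_inv_atTop_zero.comp htend)
  have h := ((profileRatio_expansion d s).comp_tendsto (htend.prodMk ht0)).trans (hO.pow 3)
  refine h.congr' ?_ EventuallyEq.rfl
  filter_upwards [htend.eventually_ge_atTop 1] with n hn
  have hpos : 0 < latticeNorm n := by linarith
  have h1 : latticeNorm n * Real.sqrt (1 + e n / latticeNorm n ^ 2) = ρ n := by
    rw [← Real.sqrt_sq (hρ0 n), hρ n]
    nth_rewrite 1 [← Real.sqrt_sq hpos.le]
    rw [← Real.sqrt_mul (sq_nonneg _)]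
    congr 1
    field_simp
  simp only [Function.comp_apply, h1]

theorem logWeight_nonneg {s : ℕ} {x : ℝ} (hx : ∀ i ≤ s, 1 ≤ iterLog i x) {i : ℕ} (hi : i ≤ s) :
    0 ≤ logWeight i x :=
  Finset.prod_nonneg fun k hk => one_div_nonneg.2
    (by linarith [hx k ((Finset.mem_Icc.1 hk).2.trans hi)])

/-- For `s ≥ 1` the quotient `(Δb)ₙ / bₙ` of the critical profile exceeds its leading terms. With
`T` and `U` the sums `logWeightSum` and `logWeightQuad`, the second-order expansion has the surplus
`(U / 2 + T ^ 2 / 4) / |n| ^ 2`, which is at least `1 / (2 |n| ^ 2 (log |n|) ^ 2)` and absorbs the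
error `O(|n| ^ (-3))`. -/
theorem eventually_le_sum_profileRatio (d s : ℕ) (hs : 1 ≤ s) :
    ∀ᶠ n : Fin d → ℤ in comap latticeNorm atTop,
      (d : ℝ) * (4 - d) / (4 * latticeNorm n ^ 2) +
          1 / latticeNorm n ^ 2 * logWeightSum s (latticeNorm n) ≤
        -2 * (d : ℝ) + ∑ j : Fin d,
          (profileRatio d s (latticeNorm n) (latticeNorm (n + latticeBasis j)) +
            profileRatio d s (latticeNorm n) (latticeNorm (n - latticeBasis j))) := by
  have htend : Tendsto (latticeNorm (d := d)) (comap latticeNorm atTop) atTop := tendsto_comap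
  have hadd := fun j : Fin d => profileRatio_lattice_expansion s
    (e := fun n => 2 * n j + 1) (ρ := fun n => latticeNorm (n + latticeBasis j))
    (fun n => by
      have := abs_le.1 (abs_apply_le_latticeNorm n j)
      rw [abs_le]; constructor <;> linarith [this.1, this.2])
    (fun n => latticeNorm_nonneg _) (fun n => latticeNorm_add_basis_sq n j)
  have hsub := fun j : Fin d => profileRatio_lattice_expansion s
    (e := fun n => -2 * n j + 1) (ρ := fun n => latticeNorm (n - latticeBasis j))
    (fun n => by
      have := abs_le.1 (abs_apply_le_latticeNorm n j)
      rw [abs_le]; constructor <;> linarith [this.1, this.2])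
    (fun n => latticeNorm_nonneg _) (fun n => latticeNorm_sub_basis_sq n j)
  obtain ⟨C, hC⟩ := (IsBigO.fun_sum (s := Finset.univ)
    fun (j : Fin d) _ => (hadd j).add (hsub j)).bound
  obtain ⟨X, hX1, hX⟩ := exists_forall_one_le_iterLog s
  have hlog : ∀ᶠ r : ℝ in atTop, 2 * |C| * Real.log r ^ 2 ≤ r := by
    have h := (isLittleO_iff.1 (Real.isLittleO_pow_log_id_atTop (n := 2)))
      (c := (2 * |C| + 1)⁻¹) (by positivity)
    filter_upwards [h, eventually_ge_atTop 0] with r hr hr0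
    rw [Real.norm_of_nonneg (sq_nonneg _), id, Real.norm_of_nonneg hr0,
      ← div_eq_inv_mul, le_div_iff₀ (by positivity)] at hr
    nlinarith [sq_nonneg (Real.log r)]
  filter_upwards [hC, htend.eventually_ge_atTop X, htend.eventually hlog] with n hC hXn hlog
  have hr1 : 1 ≤ latticeNorm n := hX1.trans hXn
  have hsq := latticeNorm_sq n
  have hL := hX _ hXn
  set r := latticeNorm n with hr
  have hr0 : 0 < r := by linarith
  set T := logWeightSum s r with hT
  set U := logWeightQuad s r with hU
  have hTU : T ^ 2 ≤ 2 * U := sq_logWeightSum_le s r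
  have hl1 : 1 ≤ Real.log r := hL 1 hs
  have hTlog : 1 / Real.log r ≤ T := by
    have h1 : logWeight 1 r = 1 / Real.log r := by simp [logWeight, iterLog]
    rw [← h1]
    exact Finset.single_le_sum (f := fun j => logWeight j r)
      (fun j hj => logWeight_nonneg hL (Finset.mem_Icc.1 hj).2) (Finset.mem_Icc.2 ⟨le_rfl, hs⟩)
  set B : ℝ := (d + T) / 8 + U / 16 + 1 / 2 * (-(d + T) / 4) ^ 2 with hB
  have hT0 : 0 ≤ T := le_trans (by positivity) hTlog
  have hU0 : 0 ≤ U := by nlinarith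
  have hB0 : 0 ≤ B := by positivity
  -- The first-order terms in `n j` cancel, and `∑ j, (n j) ^ 2 = r ^ 2`.
  have hsum : ∑ j : Fin d, ((profileRatio d s r (latticeNorm (n + latticeBasis j)) - 1 -
      (-(d + T) / 4 * ((2 * n j + 1) / r ^ 2) + B * ((2 * n j + 1) / r ^ 2) ^ 2)) +
      (profileRatio d s r (latticeNorm (n - latticeBasis j)) - 1 -
      (-(d + T) / 4 * ((-2 * n j + 1) / r ^ 2) + B * ((-2 * n j + 1) / r ^ 2) ^ 2))) =
      ∑ j : Fin d, (profileRatio d s r (latticeNorm (n + latticeBasis j)) +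
        profileRatio d s r (latticeNorm (n - latticeBasis j))) -
      (2 * d + (-(d + T) / 4 * (2 * d) + 8 * B) / r ^ 2 + 2 * d * B / r ^ 4) := by
    have h1 : ∀ j : Fin d, ((profileRatio d s r (latticeNorm (n + latticeBasis j)) - 1 -
      (-(d + T) / 4 * ((2 * n j + 1) / r ^ 2) + B * ((2 * n j + 1) / r ^ 2) ^ 2)) +
      (profileRatio d s r (latticeNorm (n - latticeBasis j)) - 1 -
      (-(d + T) / 4 * ((-2 * n j + 1) / r ^ 2) + B * ((-2 * n j + 1) / r ^ 2) ^ 2))) =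
      (profileRatio d s r (latticeNorm (n + latticeBasis j)) +
        profileRatio d s r (latticeNorm (n - latticeBasis j))) -
      ((2 + -(d + T) / 4 * 2 / r ^ 2 + 2 * B / r ^ 4) + 8 * B / r ^ 4 * (n j : ℝ) ^ 2) := by
      intro j
      field_simp
      ring
    have h2 : ∑ j : Fin d, ((2 + -(d + T) / 4 * 2 / r ^ 2 + 2 * B / r ^ 4) +
        8 * B / r ^ 4 * (n j : ℝ) ^ 2) =
        d * (2 + -(d + T) / 4 * 2 / r ^ 2 + 2 * B / r ^ 4) + 8 * B / r ^ 4 * r ^ 2 := by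
      rw [Finset.sum_add_distrib, ← Finset.mul_sum, ← hsq]
      simp only [Finset.sum_const, Finset.card_univ, Fintype.card_fin, nsmul_eq_mul]
    rw [Finset.sum_congr rfl fun j _ => h1 j, Finset.sum_sub_distrib, h2]
    congr 1
    field_simp
    ring
  rw [hsum, Real.norm_eq_abs, Real.norm_of_nonneg (by positivity)] at hC
  have hC' := (abs_le.1 hC).1
  have hgain : |C| * r⁻¹ ^ 3 ≤ T ^ 2 / 2 / r ^ 2 := by
    have h1 : (1 / Real.log r) ^ 2 ≤ T ^ 2 := by gcongr
    have h2 : |C| / r ≤ (1 / Real.log r) ^ 2 / 2 := by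
      rw [div_pow, one_pow, div_div, div_le_div_iff₀ hr0 (by positivity)]
      linarith
    have h3 : |C| * r⁻¹ ^ 3 = |C| / r / r ^ 2 := by field_simp
    rw [h3]
    exact div_le_div_of_nonneg_right (by linarith) (by positivity)
  have hCabs : C * r⁻¹ ^ 3 ≤ |C| * r⁻¹ ^ 3 :=
    mul_le_mul_of_nonneg_right (le_abs_self C) (by positivity)
  have hmain : (-(d + T) / 4 * (2 * d) + 8 * B) / r ^ 2 =
      (d : ℝ) * (4 - d) / (4 * r ^ 2) + 1 / r ^ 2 * T + (U / 2 + T ^ 2 / 4) / r ^ 2 := by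
    rw [hB]
    field_simp
    ring
  have h4 : T ^ 2 / 2 / r ^ 2 ≤ (U / 2 + T ^ 2 / 4) / r ^ 2 := by
    gcongr
    linarith
  have h5 : 0 ≤ 2 * d * B / r ^ 4 := by positivity
  linarith

theorem theorem3p1 (d : ℕ) (hd : 1 ≤ d) (V : (Fin d → ℤ) → ℝ) :
    ((∃ s : ℕ, ∃ N : ℝ, ∀ n : Fin d → ℤ, N ≤ latticeNorm n →
        V n ≤ -2 * (d : ℝ) + ∑ j : Fin d,
          ((latticeNorm n / latticeNorm (n + latticeBasis j)) ^ ((d : ℝ) / 2) *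
              ∏ i ∈ Finset.Icc 1 s,
                Real.sqrt (iterLog i (latticeNorm n) /
                  iterLog i (latticeNorm (n + latticeBasis j))) +
            (latticeNorm n / latticeNorm (n - latticeBasis j)) ^ ((d : ℝ) / 2) *
              ∏ i ∈ Finset.Icc 1 s,
                Real.sqrt (iterLog i (latticeNorm n) /
                  iterLog i (latticeNorm (n - latticeBasis j))))) →
      (0 ∉ pmapPointSpectrum (schrodinger V) ∨ 0 ≠ infSpectrum (schrodinger V))) ∧
    ((∃ s : ℕ, ∃ N : ℝ, ∀ n : Fin d → ℤ, N ≤ latticeNorm n →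
        V n ≤ (d : ℝ) * (4 - (d : ℝ)) / (4 * latticeNorm n ^ 2) +
          1 / latticeNorm n ^ 2 *
            ∑ j ∈ Finset.Icc 1 s, ∏ k ∈ Finset.Icc 1 j, 1 / iterLog k (latticeNorm n)) →
      (0 ∉ pmapPointSpectrum (schrodinger V) ∨ 0 ≠ infSpectrum (schrodinger V))) := by
  constructor
  · rintro ⟨s, N, hV⟩
    exact no_ground_state_of_le_ratio hd hV
  · rintro ⟨s, N, hV⟩
    -- Passing to `s + 1` only weakens the bound, and provides the surplus also when `s = 0`.
    obtain ⟨X, -, hX⟩ := exists_forall_one_le_iterLog (s + 1)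
    obtain ⟨N', -, hN'⟩ := ((atTop_basis.comap latticeNorm).eventually_iff).1
      (eventually_le_sum_profileRatio d (s + 1) (by omega))
    refine no_ground_state_of_le_ratio hd (s := s + 1) (N := max N (max X N')) fun n hn => ?_
    have hnN : N ≤ latticeNorm n := (le_max_left _ _).trans hn
    have hnX : X ≤ latticeNorm n := (le_max_left _ _).trans ((le_max_right _ _).trans hn)
    have hnN' : N' ≤ latticeNorm n := (le_max_right _ _).trans ((le_max_right _ _).trans hn)
    refine (hV n hnN).trans (le_trans ?_ (hN' (show n ∈ latticeNorm ⁻¹' Set.Ici N' from hnN')))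
    have h := logWeightSum_succ s (latticeNorm n)
    have h0 := logWeight_nonneg (hX _ hnX) le_rfl
    gcongr
    change logWeightSum s (latticeNorm n) ≤ _
    linarith
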